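/- Let $(M^{2n+1},\varphi,\xi,\eta,g)$ be an almost contact metric manifold: $M$ is a smooth manifold of dimension $2n+1$, $\varphi$ a smooth $(1,1)$-tensor field, $\xi$ a smooth vector field, $\eta$ a smooth $1$-form and $g$ a Riemannian metric with $$\varphi^2=-I+\eta\otimes\xi,\quad \eta(\xi)=1,\quad \varphi\xi=0,\quad \eta\circ\varphi=0,\quad g(\varphi X,\varphi Y)=g(X,Y)-\eta(X)\eta(Y).$$ Put $\mathcal D=\ker\eta$ and $\Phi(X,Y)=g(X,\varphi Y)$. Let $\alpha\neq 0$ be a real constant and $h'=\frac{1}{2\alpha}(\mathcal L_\xi\varphi)\circ\varphi$. The structure is almost $\alpha$-Kenmotsu if $d\eta=0$ and $d\Phi=2\alpha\,\eta\wedge\Phi$. It is CR-integrable if for all sections $X,Y$ of $\mathcal D$ one has $[X,Y]-[\varphi X,\varphi Y]\in\mathcal D$ and $[\varphi X,\varphi Y]-[X,Y]-\varphi([\varphi X,Y]+[X,\varphi Y])=0$. The torsion of a linear connection $\widetilde\nabla$ is normalized by $2\widetilde T(X,Y)=\widetilde\nabla_XY-\widetilde\nabla_YX-[X,Y]$, and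 $\widetilde T_\xi=\widetilde T(\xi,\cdot)$. **Theorem.** $(\varphi,\xi,\eta,g)$ is a CR-integrable almost $\alpha$-Kenmotsu structure if and only if there exists a (smooth) linear connection $\widetilde\nabla$ on $M$ such that $\varphi$, $g$ and $\eta$ are parallel with respect to $\widetilde\nabla$ and its torsion satisfies a) $\widetilde T(X,Y)=0$ for all $X,Y\in\mathcal D$, b) $2\widetilde T(\xi,X)=\alpha(X+h'X)$ for all $X\in\mathcal D$, c) $\widetilde T_\xi$ is selfadjoint with respect to $g$. Such a connection is unique and is given by $$\widetilde\nabla_XY=\nabla_XY+\alpha\, g(X+h'X,Y)\,\xi-\alpha\,\eta(Y)(X+h'X),$$ where $\nabla$ is the Levi-Civita connection of $g$. It is invariant under $\mathcal D$-homothetic deformations: for every constant $\beta>0$, $\widetilde\nabla$ is also a connection with the above properties for the almost contact metric structure $$\bar\varphi=\varphi,\quad \bar\xi=\tfrac1\beta\xi,\quad \bar\eta=\beta\eta,\quad \bar g=\beta g+\beta(\beta-1)\eta\otimes\eta$$ and the constant $\alpha/\beta$ in place of $\alpha$. -/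

import Mathlib

open scoped Manifold ContDiff Bundle

noncomputable section

section AlmostContact

variable {E : Type*} [NormedAddCommGroup E] [NormedSpace ℝ E]
  {H : Type*} [TopologicalSpace H]

/-- An almost contact metric structure `(φ, ξ, η, g)` on the smooth manifold `M`: a smooth
`(1,1)`-tensor field, a smooth vector field, a smooth `1`-form and a smooth Riemannian metric. -/
structure AlmostContactMetricStructure (I : ModelWithCorners ℝ E H)
    (M : Type*) [TopologicalSpace M] [ChartedSpace H M] [IsManifold I ∞ M] where
  /-- the `(1,1)`-tensor field -/
  φ : ∀ x : M, TangentSpace I x →L[ℝ] TangentSpace I x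
  /-- the characteristic vector field -/
  ξ : ∀ x : M, TangentSpace I x
  /-- the `1`-form -/
  η : ∀ x : M, TangentSpace I x →L[ℝ] ℝ
  /-- the Riemannian metric -/
  g : Bundle.ContMDiffRiemannianMetric I ∞ E (fun x : M => TangentSpace I x)
  contMDiff_φ : ContMDiff I (I.prod 𝓘(ℝ, E →L[ℝ] E)) ∞
    (fun x => Bundle.TotalSpace.mk' (E →L[ℝ] E)
      (E := fun x : M => TangentSpace I x →L[ℝ] TangentSpace I x) x (φ x))
  contMDiff_ξ : ContMDiff I (I.prod 𝓘(ℝ, E)) ∞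
    (fun x => Bundle.TotalSpace.mk' E (E := fun x : M => TangentSpace I x) x (ξ x))
  contMDiff_η : ContMDiff I (I.prod 𝓘(ℝ, E →L[ℝ] ℝ)) ∞
    (fun x => Bundle.TotalSpace.mk' (E →L[ℝ] ℝ)
      (E := fun x : M => TangentSpace I x →L[ℝ] Bundle.Trivial M ℝ x) x (η x))
  φ_φ : ∀ (x : M) (v : TangentSpace I x), φ x (φ x v) = -v + η x v • ξ x
  η_ξ : ∀ x : M, η x (ξ x) = 1
  φ_ξ : ∀ x : M, φ x (ξ x) = 0
  η_φ : ∀ (x : M) (v : TangentSpace I x), η x (φ x v) = 0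
  g_φ_φ : ∀ (x : M) (v w : TangentSpace I x),
    g.inner x (φ x v) (φ x w) = g.inner x v w - η x v * η x w

variable {I : ModelWithCorners ℝ E H}
  {M : Type*} [TopologicalSpace M] [ChartedSpace H M] [IsManifold I ∞ M]

namespace AlmostContactMetricStructure

/-! ### The `D`-homothetic deformation -/

set_option synthInstance.maxHeartbeats 200000 in
/-- The tensor square of a smooth `1`-form is smooth. -/
theorem contMDiff_smulRight_self {η : ∀ x : M, TangentSpace I x →L[ℝ] ℝ}
    (hη : ContMDiff I (I.prod 𝓘(ℝ, E →L[ℝ] ℝ)) ∞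
      (fun x => Bundle.TotalSpace.mk' (E →L[ℝ] ℝ)
        (E := fun x : M => TangentSpace I x →L[ℝ] Bundle.Trivial M ℝ x) x (η x))) :
    ContMDiff I (I.prod 𝓘(ℝ, E →L[ℝ] E →L[ℝ] ℝ)) ∞
      (fun x => Bundle.TotalSpace.mk' (E →L[ℝ] E →L[ℝ] ℝ)
        (E := fun x : M => TangentSpace I x →L[ℝ] TangentSpace I x →L[ℝ] Bundle.Trivial M ℝ x) x
        ((η x).smulRight (η x))) := by
  intro x₀
  have h := (contMDiffAt_hom_bundle _).1 (hη x₀)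
  refine (contMDiffAt_hom_bundle _).2 ⟨contMDiffAt_id, ?_⟩
  have h2 := h.2
  have h3 : ContMDiffAt I 𝓘(ℝ, E →L[ℝ] E →L[ℝ] ℝ) ∞ (fun x =>
      (ContinuousLinearMap.inCoordinates E (fun x : M => TangentSpace I x) ℝ
        (Bundle.Trivial M ℝ) x₀ x x₀ x (η x)).smulRight
      (ContinuousLinearMap.inCoordinates E (fun x : M => TangentSpace I x) ℝ
        (Bundle.Trivial M ℝ) x₀ x x₀ x (η x))) x₀ := by
    have hb : ContDiff ℝ ∞ (fun f : E →L[ℝ] ℝ => f.smulRight f) :=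
      ContDiff.comp (g := fun p : (E →L[ℝ] ℝ) × (E →L[ℝ] ℝ) => p.1.smulRight p.2)
        isBoundedBilinearMap_smulRight.contDiff (contDiff_id.prodMk contDiff_id)
    exact hb.contMDiff.contMDiffAt.comp x₀ h2
  refine h3.congr_of_eventuallyEq ?_
  filter_upwards [(trivializationAt E (TangentSpace I : M → Type _) x₀).open_baseSet.mem_nhds
    (FiberBundle.mem_baseSet_trivializationAt' x₀)] with x hx
  have hx' : x ∈ (trivializationAt (E →L[ℝ] ℝ)
      (fun b : M => TangentSpace I b →L[ℝ] Bundle.Trivial M ℝ b) x₀).baseSet := by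
    simpa using hx
  ext v w
  simp only [ContinuousLinearMap.inCoordinates, ContinuousLinearMap.comp_apply,
    ContinuousLinearMap.smulRight_apply, map_smul, smul_apply]
  congr 1
  · simp
  rw [Bundle.Trivialization.continuousLinearMapAt_apply,
    Bundle.Trivialization.coe_linearMapAt_of_mem _ hx']
  rfl

theorem η_sq_le (S : AlmostContactMetricStructure I M) (x : M) (v : TangentSpace I x) :
    S.η x v * S.η x v ≤ S.g.inner x v v := by
  have h := S.g_φ_φ x v v
  rcases eq_or_ne (S.φ x v) 0 with h0 | h0
  · rw [h0] at h
    simp at h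
    linarith
  · have := S.g.pos x _ h0
    linarith

theorem min_mul_le (S : AlmostContactMetricStructure I M) {β : ℝ} (hβ : 0 < β) (x : M)
    (v : TangentSpace I x) :
    min β (β ^ 2) * S.g.inner x v v ≤
      (β • S.g.inner x + (β * (β - 1)) • (S.η x).smulRight (S.η x)) v v := by
  have h1 := S.η_sq_le x v
  have h2 : 0 ≤ S.η x v * S.η x v := mul_self_nonneg _
  simp only [add_apply, smul_apply,
    ContinuousLinearMap.smulRight_apply, smul_eq_mul]
  rcases le_total 1 β with h | h
  · rw [min_eq_left (by nlinarith)]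
    have : 0 ≤ β * (β - 1) * (S.η x v * S.η x v) :=
      mul_nonneg (mul_nonneg hβ.le (by linarith)) h2
    linarith
  · rw [min_eq_right (by nlinarith)]
    have : 0 ≤ β * (1 - β) * (S.g.inner x v v - S.η x v * S.η x v) :=
      mul_nonneg (mul_nonneg hβ.le (by linarith)) (by linarith)
    nlinarith

set_option synthInstance.maxHeartbeats 200000 in
/-- The `D`-homothetic deformation
`φ' = φ`, `ξ' = (1/β) ξ`, `η' = β η`, `g' = β g + β (β - 1) η ⊗ η` with constant `β > 0`. -/
def deform (S : AlmostContactMetricStructure I M) (β : ℝ) (hβ : 0 < β) :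
    AlmostContactMetricStructure I M where
  φ := S.φ
  ξ x := (1 / β) • S.ξ x
  η x := β • S.η x
  g :=
    { inner := fun x => β • S.g.inner x + (β * (β - 1)) • (S.η x).smulRight (S.η x)
      symm := fun x v w => by
        have := S.g.symm x v w
        simp only [add_apply, smul_apply,
          ContinuousLinearMap.smulRight_apply, smul_eq_mul, this]
        ring
      pos := fun x v hv => by
        have h0 := S.g.pos x v hv
        have h1 := S.min_mul_le hβ x v
        exact lt_of_lt_of_le (mul_pos (lt_min hβ (pow_pos hβ 2)) h0) h1
      isVonNBounded := fun x => by
        set c : ℝ := min β (β ^ 2) with hc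
        have hc0 : 0 < c := lt_min hβ (pow_pos hβ 2)
        have hs : 0 < √c := Real.sqrt_pos.2 hc0
        have him := (S.g.isVonNBounded x).image
          ((√c)⁻¹ • ContinuousLinearMap.id ℝ (TangentSpace I x))
        refine him.subset fun v hv => ?_
        refine ⟨√c • v, ?_, ?_⟩
        · have h1 := S.min_mul_le hβ x v
          have h2 : S.g.inner x (√c • v) (√c • v) = c * S.g.inner x v v := by
            simp only [map_smul, smul_apply, smul_eq_mul]
            rw [← mul_assoc, Real.mul_self_sqrt hc0.le]
          exact (h2.trans_le h1).trans_lt hv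
        · simp [smul_smul, hs.ne']
      contMDiff :=
        (S.g.contMDiff.const_smul_section (a := β)).add_section
          ((contMDiff_smulRight_self S.contMDiff_η).const_smul_section (a := β * (β - 1))) }
  contMDiff_φ := S.contMDiff_φ
  contMDiff_ξ := S.contMDiff_ξ.const_smul_section (a := 1 / β)
  contMDiff_η := S.contMDiff_η.const_smul_section (a := β)
  φ_φ x v := by
    simp [S.φ_φ, smul_smul, mul_comm, hβ.ne']
  η_ξ x := by simp [S.η_ξ, hβ.ne']
  φ_ξ x := by simp [S.φ_ξ]
  η_φ x v := by simp [S.η_φ]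
  g_φ_φ x v w := by
    simp [S.η_φ, S.g_φ_φ]; ring

/-! ### The tensor field `h'` -/

variable (S : AlmostContactMetricStructure I M)

theorem mdifferentiableAt_φ {X : ∀ x : M, TangentSpace I x} {x : M}
    (hX : MDiffAt (T% X) x) : MDiffAt (T% (fun y => S.φ y (X y))) x :=
  ((S.contMDiff_φ x).mdifferentiableAt (by simp)).clm_bundle_apply hX

variable [CompleteSpace E]

theorem lieDeriv_tensorial (x : M) :
    TensorialAt I E (fun X : (∀ y : M, TangentSpace I y) =>
      VectorField.mlieBracket I S.ξ (fun y => S.φ y (X y)) x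
        - S.φ x (VectorField.mlieBracket I S.ξ X x)) x where
  smul {f X} hf hX := by
    have h1 : (fun y => S.φ y ((f • X) y)) = f • (fun y => S.φ y (X y)) := by
      ext y; simp
    simp only [h1]
    rw [VectorField.mlieBracket_smul_right hf (S.mdifferentiableAt_φ hX),
      VectorField.mlieBracket_smul_right hf hX]
    simp [smul_sub]
  add {X Y} hX hY := by
    have h1 : (fun y => S.φ y ((X + Y) y)) = (fun y => S.φ y (X y)) + (fun y => S.φ y (Y y)) := by
      ext y; simp
    simp only [h1]
    rw [VectorField.mlieBracket_add_right (S.mdifferentiableAt_φ hX) (S.mdifferentiableAt_φ hY),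
      VectorField.mlieBracket_add_right hX hY]
    simp; abel

variable [FiniteDimensional ℝ E]

/-- The Lie derivative `L_ξ φ`, a `(1,1)`-tensor field: `(L_ξ φ) X = [ξ, φ X] - φ [ξ, X]`. -/
def lieDeriv (x : M) : TangentSpace I x →L[ℝ] TangentSpace I x :=
  TensorialAt.mkHom _ x (S.lieDeriv_tensorial x)

theorem lieDeriv_apply {x : M} {X : ∀ x : M, TangentSpace I x} (hX : MDiffAt (T% X) x) :
    S.lieDeriv x (X x) = VectorField.mlieBracket I S.ξ (fun y => S.φ y (X y)) x
      - S.φ x (VectorField.mlieBracket I S.ξ X x) :=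
  TensorialAt.mkHom_apply (S.lieDeriv_tensorial x) hX

/-- The tensor field `h' = (1 / 2α) (L_ξ φ) ∘ φ`. -/
def hPrime (α : ℝ) (x : M) : TangentSpace I x →L[ℝ] TangentSpace I x :=
  (1 / (2 * α)) • (S.lieDeriv x).comp (S.φ x)

end AlmostContactMetricStructure

/-! ### Exterior derivatives on differentiable vector fields -/

/-- `dθ(X, Y) = X(θ(Y)) - Y(θ(X)) - θ([X, Y])` for a `1`-form `θ`. -/
def extDerivOne (θ : ∀ x : M, TangentSpace I x → ℝ) (X Y : ∀ x : M, TangentSpace I x) (x : M) : ℝ :=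
  mvfderiv I (fun y => θ y (Y y)) x (X x) - mvfderiv I (fun y => θ y (X y)) x (Y x)
    - θ x (VectorField.mlieBracket I X Y x)

/-- `dΩ(X, Y, Z)` for a `2`-form `Ω`, the cyclic sum of `X(Ω(Y, Z)) - Ω([X, Y], Z)`. -/
def extDerivTwo (Ω : ∀ x : M, TangentSpace I x → TangentSpace I x → ℝ)
    (X Y Z : ∀ x : M, TangentSpace I x) (x : M) : ℝ :=
  mvfderiv I (fun y => Ω y (Y y) (Z y)) x (X x)
    + mvfderiv I (fun y => Ω y (Z y) (X y)) x (Y x)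
    + mvfderiv I (fun y => Ω y (X y) (Y y)) x (Z x)
    - Ω x (VectorField.mlieBracket I X Y x) (Z x)
    - Ω x (VectorField.mlieBracket I Y Z x) (X x)
    - Ω x (VectorField.mlieBracket I Z X x) (Y x)

/-- `(θ ∧ Ω)(u, v, w)` for a `1`-form `θ` and a `2`-form `Ω`: a cyclic sum, with the same
normalization as `extDerivTwo`. -/
def wedgeOneTwo (θ : ∀ x : M, TangentSpace I x → ℝ)
    (Ω : ∀ x : M, TangentSpace I x → TangentSpace I x → ℝ) (x : M) (u v w : TangentSpace I x) : ℝ :=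
  θ x u * Ω x v w + θ x v * Ω x w u + θ x w * Ω x u v

/-! ### Linear connections -/

variable (I M) in
/-- Linear connections on `M`: covariant derivatives on the tangent bundle, `D Y x v` being
`(∇_v Y)(x)`. Smoothness is required separately. -/
abbrev LinearConnection : Type _ := CovariantDerivative I E (TangentSpace I : M → Type _)

section Connection

variable (D : LinearConnection I M)

/-- The metric `g` is parallel: `X(g(Y, Z)) = g(∇_X Y, Z) + g(Y, ∇_X Z)`. -/
def IsParallelMetric (g : Bundle.ContMDiffRiemannianMetric I ∞ E (fun x : M => TangentSpace I x)) :
    Prop :=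
  ∀ (x : M) (v : TangentSpace I x) (Y Z : ∀ x : M, TangentSpace I x),
    MDiffAt (T% Y) x → MDiffAt (T% Z) x →
      mvfderiv I (fun y => g.inner y (Y y) (Z y)) x v
        = g.inner x (D Y x v) (Z x) + g.inner x (Y x) (D Z x v)

/-- The `(1,1)`-tensor field `A` is parallel: `∇_X (A Y) = A (∇_X Y)`. -/
def IsParallelEndo (A : ∀ x : M, TangentSpace I x →L[ℝ] TangentSpace I x) : Prop :=
  ∀ (x : M) (v : TangentSpace I x) (Y : ∀ x : M, TangentSpace I x), MDiffAt (T% Y) x →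
    D (fun y => A y (Y y)) x v = A x (D Y x v)

/-- The `1`-form `θ` is parallel: `X(θ(Y)) = θ(∇_X Y)`. -/
def IsParallelOneForm (θ : ∀ x : M, TangentSpace I x →L[ℝ] ℝ) : Prop :=
  ∀ (x : M) (v : TangentSpace I x) (Y : ∀ x : M, TangentSpace I x), MDiffAt (T% Y) x →
    mvfderiv I (fun y => θ y (Y y)) x v = θ x (D Y x v)

variable [FiniteDimensional ℝ E] [CompleteSpace E]

/-- The torsion normalized by `2 T(X, Y) = ∇_X Y - ∇_Y X - [X, Y]`. -/
def halfTorsion (x : M) : TangentSpace I x →L[ℝ] TangentSpace I x →L[ℝ] TangentSpace I x :=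
  (1 / 2 : ℝ) • D.torsion x

/-- `D` is the Levi-Civita connection of `g`: smooth, metric and torsion free. -/
structure IsLeviCivita
    (g : Bundle.ContMDiffRiemannianMetric I ∞ E (fun x : M => TangentSpace I x)) : Prop where
  smooth : D.ContMDiffCovariantDerivative ∞
  metric : IsParallelMetric D g
  torsion_eq_zero : ∀ x : M, D.torsion x = 0

end Connection

namespace AlmostContactMetricStructure

variable (S : AlmostContactMetricStructure I M)

/-- The fundamental `2`-form `Φ(X, Y) = g(X, φ Y)`. -/
def fundamentalForm (x : M) (v w : TangentSpace I x) : ℝ := S.g.inner x v (S.φ x w)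

/-- The almost `CR`-structure `(D, J)`, `D = ker η`, `J = φ` on `D`, is integrable: for sections
`X, Y` of `D`, `[X, Y] - [JX, JY]` is a section of `D` and
`[JX, JY] - [X, Y] - J([JX, Y] + [X, JY]) = 0`. -/
def IsCRIntegrable : Prop :=
  ∀ (X Y : ∀ x : M, TangentSpace I x), (∀ x, S.η x (X x) = 0) → (∀ x, S.η x (Y x) = 0) →
    ∀ x : M, MDiffAt (T% X) x → MDiffAt (T% Y) x →
      S.η x (VectorField.mlieBracket I X Y x
        - VectorField.mlieBracket I (fun y => S.φ y (X y)) (fun y => S.φ y (Y y)) x) = 0 ∧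
      VectorField.mlieBracket I (fun y => S.φ y (X y)) (fun y => S.φ y (Y y)) x
        - VectorField.mlieBracket I X Y x
        - S.φ x (VectorField.mlieBracket I (fun y => S.φ y (X y)) Y x
          + VectorField.mlieBracket I X (fun y => S.φ y (Y y)) x) = 0

/-- The structure is almost `α`-Kenmotsu: `dη = 0` and `dΦ = 2 α η ∧ Φ`. -/
structure IsAlmostKenmotsu (α : ℝ) : Prop where
  d_η : ∀ (x : M) (X Y : ∀ x : M, TangentSpace I x), MDiffAt (T% X) x → MDiffAt (T% Y) x →
    extDerivOne (fun y v => S.η y v) X Y x = 0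
  d_Φ : ∀ (x : M) (X Y Z : ∀ x : M, TangentSpace I x),
    MDiffAt (T% X) x → MDiffAt (T% Y) x → MDiffAt (T% Z) x →
    extDerivTwo S.fundamentalForm X Y Z x
      = 2 * α * wedgeOneTwo (fun y v => S.η y v) S.fundamentalForm x (X x) (Y x) (Z x)

/-- `D` is a smooth linear connection for which `φ`, `g`, `η` are parallel and whose torsion `T`
(with `2 T(X, Y) = ∇_X Y - ∇_Y X - [X, Y]`) satisfies a) `T(X, Y) = 0` for `X, Y` in `ker η`,
b) `2 T(ξ, X) = α (X + h' X)` for `X` in `ker η`, c) `T(ξ, ·)` is selfadjoint. -/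
structure IsCanonicalConnection [FiniteDimensional ℝ E] [CompleteSpace E] (α : ℝ)
    (D : LinearConnection I M) : Prop where
  smooth : D.ContMDiffCovariantDerivative ∞
  parallel_φ : IsParallelEndo D S.φ
  parallel_g : IsParallelMetric D S.g
  parallel_η : IsParallelOneForm D S.η
  torsion_D : ∀ (x : M) (v w : TangentSpace I x), S.η x v = 0 → S.η x w = 0 →
    halfTorsion D x v w = 0
  torsion_ξ : ∀ (x : M) (v : TangentSpace I x), S.η x v = 0 →
    (2 : ℝ) • halfTorsion D x (S.ξ x) v = α • (v + S.hPrime α x v)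
  torsion_selfadjoint : ∀ (x : M) (v w : TangentSpace I x),
    S.g.inner x (halfTorsion D x (S.ξ x) v) w = S.g.inner x v (halfTorsion D x (S.ξ x) w)

end AlmostContactMetricStructure
end AlmostContact
end

/-! Write K = I + h' and let T be the torsion without the factor 1/2. Since Kξ = ξ, conditions a)
and b) amount to the single formula T(X,Y) = α(η(X) KY − η(Y) KX) (`torsion_eq`), and c) then says
that K is selfadjoint. A metric connection is determined by its torsion
(`eq_of_isParallelMetric_of_torsion_eq`), so there is at most one candidate. `shift` adds to a
connection a term that is skew with respect to g; applied to the Levi-Civita connection ∇ it gives a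
metric connection, which has the required torsion whenever K is selfadjoint. Uniqueness and the
explicit formula follow together. The Levi-Civita connection itself is built from the Koszul
formula.

Existence. The equation dη = 0 makes ∇ξ selfadjoint, and dΦ evaluated on ξ then gives ∇_X ξ = α(KX −
η(X)ξ) (`IsAlmostKenmotsu.connection_ξ`). Hence K is selfadjoint and the shifted connection
annihilates ξ, so it makes η parallel. To see that φ is parallel, consider its covariant derivative
as a tensor. In the direction ξ, comparison with L_ξφ forces φh'φ = h' on ker η and then the
vanishing of the derivative (`nablaPhi_apply_ξ`). Along ker η the torsion vanishes, so dΦ and the CR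
condition become the closedness and integrability conditions of an almost Kähler structure, and the
classical argument that such a structure is Kähler applies (`nablaPhi_eq_zero_of_η_eq_zero`).

Converse. When φ, g and η are parallel, dη, dΦ and the Nijenhuis expression depend on T alone.
Closedness of η comes from η ∘ K = η, the equation for dΦ from φK + Kφ = 2φ, and CR-integrability
from T = 0 on ker η.

Deformation. The factors of β cancel both in h' and in the product αη, so K and the torsion formula
are unchanged. -/

open scoped Manifold ContDiff Bundle

noncomputable section

/-! ### Smoothness of tensor fields, tested on smooth vector fields -/

section SmoothTensors

variable {E : Type*} [NormedAddCommGroup E] [NormedSpace ℝ E]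
  {H : Type*} [TopologicalSpace H] {I : ModelWithCorners ℝ E H}
  {M : Type*} [TopologicalSpace M] [ChartedSpace H M]

/-- A family of continuous linear maps out of a finite-dimensional space is smooth as soon as it
is pointwise smooth. -/
theorem contMDiffAt_clm_of_apply [FiniteDimensional ℝ E]
    {F : Type*} [NormedAddCommGroup F] [NormedSpace ℝ F]
    {f : M → E →L[ℝ] F} {x₀ : M} {k : ℕ∞ω}
    (h : ∀ v, ContMDiffAt I 𝓘(ℝ, F) k (fun x => f x v) x₀) :
    ContMDiffAt I 𝓘(ℝ, E →L[ℝ] F) k f x₀ := by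
  let b := Module.finBasis ℝ E
  have hf : f = fun x => ∑ i,
      ContinuousLinearMap.smulRightL ℝ E F (LinearMap.toContinuousLinearMap (b.coord i))
        (f x (b i)) := by
    funext x
    ext v
    conv_lhs => rw [← b.sum_repr v]
    rw [map_sum]
    simp
  rw [hf]
  exact contMDiffAt_finsetSum fun i _ =>
    (ContinuousLinearMap.contMDiff _).contMDiffAt.comp x₀ (h (b i))

/-- A positive definite bilinear form on a finite-dimensional space is nondegenerate. -/
theorem isInvertible_of_pos [FiniteDimensional ℝ E] {b : E →L[ℝ] E →L[ℝ] ℝ}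
    (hb : ∀ v, v ≠ 0 → 0 < b v v) : b.IsInvertible := by
  have hinj : Function.Injective b := by
    rw [injective_iff_map_eq_zero]
    intro u hu
    by_contra hne
    have h1 := hb u hne
    simp [hu] at h1
  have hdim : Module.finrank ℝ E = Module.finrank ℝ (E →L[ℝ] ℝ) := by
    rw [← (LinearMap.toContinuousLinearMap (𝕜 := ℝ) (E := E) (F' := ℝ)).finrank_eq]
    exact (Subspace.dual_finrank_eq (K := ℝ) (V := E)).symm
  exact ⟨(LinearEquiv.ofInjectiveOfFinrankEq b.toLinearMap hinj hdim).toContinuousLinearEquiv,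
    by ext; rfl⟩

variable [IsManifold I ∞ M]

/-- Fields with constant coordinates in a local trivialization; they are the test fields for the
criteria below. -/
theorem contMDiffAt_symmL_trivializationAt (x₀ : M) (v : E) :
    CMDiffAt ∞ (T% (fun x : M =>
      (trivializationAt E (TangentSpace I : M → Type _) x₀).symmL ℝ x v)) x₀ := by
  have ht := FiberBundle.mem_baseSet_trivializationAt' (F := E)
    (E := (TangentSpace I : M → Type _)) x₀
  have hX := FiberBundle.contMDiffAt_extend I E (k := ∞) (V := (TangentSpace I : M → Type _))
    ((trivializationAt E (TangentSpace I : M → Type _) x₀).symmL ℝ x₀ v)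
  refine hX.congr_of_eventuallyEq ?_
  filter_upwards [(trivializationAt E (TangentSpace I : M → Type _) x₀).open_baseSet.mem_nhds ht]
    with x hx
  simp only [FiberBundle.extend]
  rw [Bundle.Trivialization.symmL_apply _ hx, Bundle.Trivialization.symmL_apply _ ht,
    Bundle.Trivialization.apply_mk_symm _ ht]

/-- An endomorphism field of the tangent bundle is smooth as soon as it maps smooth vector fields
to smooth vector fields. -/
theorem contMDiffAt_endo_of_apply [FiniteDimensional ℝ E]
    {A : ∀ x : M, TangentSpace I x →L[ℝ] TangentSpace I x} {x₀ : M}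
    (h : ∀ X : ∀ x : M, TangentSpace I x, CMDiffAt ∞ (T% X) x₀ →
      CMDiffAt ∞ (T% (fun x => A x (X x))) x₀) :
    ContMDiffAt I (I.prod 𝓘(ℝ, E →L[ℝ] E)) ∞
      (fun x => Bundle.TotalSpace.mk' (E →L[ℝ] E)
        (E := fun x : M => TangentSpace I x →L[ℝ] TangentSpace I x) x (A x)) x₀ := by
  refine (contMDiffAt_hom_bundle _).2 ⟨contMDiffAt_id, contMDiffAt_clm_of_apply fun v => ?_⟩
  have h1 := (Bundle.contMDiffAt_totalSpace.1
    (h _ (contMDiffAt_symmL_trivializationAt x₀ v))).2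
  refine h1.congr_of_eventuallyEq ?_
  filter_upwards [(trivializationAt E (TangentSpace I : M → Type _) x₀).open_baseSet.mem_nhds
    (FiberBundle.mem_baseSet_trivializationAt' x₀)] with x hx
  simp only [ContinuousLinearMap.inCoordinates, ContinuousLinearMap.comp_apply]
  rw [Bundle.Trivialization.continuousLinearMapAt_apply,
    Bundle.Trivialization.coe_linearMapAt_of_mem _ hx]

/-- A vector field is smooth as soon as its inner products with smooth vector fields are. -/
theorem contMDiffAt_of_inner [FiniteDimensional ℝ E]
    (g : Bundle.ContMDiffRiemannianMetric I ∞ E (fun x : M => TangentSpace I x))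
    {W : ∀ x : M, TangentSpace I x} {x₀ : M}
    (h : ∀ Z : ∀ x : M, TangentSpace I x, CMDiffAt ∞ (T% Z) x₀ →
      CMDiffAt ∞ (fun x => g.inner x (W x) (Z x)) x₀) :
    CMDiffAt ∞ (T% W) x₀ := by
  have : CompleteSpace E := FiniteDimensional.complete ℝ E
  set t := trivializationAt E (TangentSpace I : M → Type _) x₀ with ht_def
  have ht : x₀ ∈ t.baseSet := FiberBundle.mem_baseSet_trivializationAt' x₀
  -- `G` is the Gram form of the metric in the trivialization. The coordinates of W are `G`⁻¹
  -- applied to the pairings of W with the frame, and inversion is smooth at an invertible map.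
  let G : M → E →L[ℝ] E →L[ℝ] ℝ := fun x =>
    (ContinuousLinearMap.precomp ℝ (t.symmL ℝ x)).comp ((g.inner x).comp (t.symmL ℝ x))
  have hG : ContMDiffAt I 𝓘(ℝ, E →L[ℝ] E →L[ℝ] ℝ) ∞ G x₀ := by
    refine contMDiffAt_clm_of_apply fun u => contMDiffAt_clm_of_apply fun v => ?_
    have := (g.contMDiff x₀).clm_bundle_apply₂ (F₃ := ℝ)
      (contMDiffAt_symmL_trivializationAt x₀ u) (contMDiffAt_symmL_trivializationAt x₀ v)
    exact (Bundle.contMDiffAt_totalSpace.1 this).2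
  have hinv : ∀ x ∈ t.baseSet, (G x).IsInvertible := by
    intro x hx
    refine isInvertible_of_pos fun u hu => g.pos x (t.symmL ℝ x u) fun h0 => hu ?_
    have h1 := t.continuousLinearMapAt_symmL (R := ℝ) hx u
    rw [h0, map_zero] at h1
    exact h1.symm
  have h1 : ContMDiffAt I 𝓘(ℝ, E →L[ℝ] ℝ) ∞
      (fun x => (g.inner x (W x)).comp (t.symmL ℝ x)) x₀ :=
    contMDiffAt_clm_of_apply fun v => h _ (contMDiffAt_symmL_trivializationAt x₀ v)
  have h2 : ContMDiffAt I 𝓘(ℝ, (E →L[ℝ] ℝ) →L[ℝ] E) ∞ (fun x => (G x).inverse) x₀ :=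
    (hinv x₀ ht).contDiffAt_map_inverse.contMDiffAt.comp x₀ hG
  refine Bundle.contMDiffAt_totalSpace.2 ⟨contMDiffAt_id, ?_⟩
  refine (h2.clm_apply h1).congr_of_eventuallyEq ?_
  filter_upwards [t.open_baseSet.mem_nhds ht] with x hx
  have h3 : (g.inner x (W x)).comp (t.symmL ℝ x) = G x (t.continuousLinearMapAt ℝ x (W x)) := by
    ext v
    change _ = g.inner x (t.symmL ℝ x (t.continuousLinearMapAt ℝ x (W x))) (t.symmL ℝ x v)
    rw [t.symmL_continuousLinearMapAt hx]
    rfl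
  rw [h3, (hinv x hx).inverse_apply_self]
  rw [Bundle.Trivialization.continuousLinearMapAt_apply,
    Bundle.Trivialization.coe_linearMapAt_of_mem _ hx]

theorem contMDiffAt_mvfderiv_apply {f : M → ℝ} {X : ∀ x : M, TangentSpace I x} {x₀ : M}
    (hf : CMDiffAt ∞ f x₀) (hX : CMDiffAt ∞ (T% X) x₀) :
    CMDiffAt ∞ (fun x => mvfderiv I f x (X x)) x₀ := by
  have h1 := hf.mfderiv_const (m := ∞) (by simp)
  have h2 := (Bundle.contMDiffAt_totalSpace.1 hX).2
  refine (h1.clm_apply h2).congr_of_eventuallyEq ?_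
  filter_upwards [(trivializationAt E (TangentSpace I : M → Type _) x₀).open_baseSet.mem_nhds
    (FiberBundle.mem_baseSet_trivializationAt' x₀)] with x hx
  have h3 := (trivializationAt E (TangentSpace I : M → Type _) x₀).symmL_continuousLinearMapAt
    (R := ℝ) hx (X x)
  rw [Bundle.Trivialization.continuousLinearMapAt_apply,
    Bundle.Trivialization.coe_linearMapAt_of_mem _ hx] at h3
  simp only [inTangentCoordinates, ContinuousLinearMap.inCoordinates,
    ContinuousLinearMap.comp_apply, id]
  rw [h3]
  simp [mvfderiv]
  rfl

theorem eventually_mdifferentiableAt {X : ∀ x : M, TangentSpace I x} {x : M}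
    (hX : CMDiffAt ∞ (T% X) x) : ∀ᶠ y in nhds x, MDiffAt (T% X) y :=
  -- The neighbourhood on which a field is C^k may shrink with k, so the passage to nearby points is
  -- made at order 1.
  ((contMDiffAt_iff_contMDiffAt_nhds (by simp)).1 (hX.of_le (m := 1) (by simp))).mono
    fun _ hy => hy.mdifferentiableAt (by simp)

end SmoothTensors

/-! ### The Levi-Civita connection from the Koszul formula -/

section LeviCivita

variable {E : Type*} [NormedAddCommGroup E] [NormedSpace ℝ E]
  {H : Type*} [TopologicalSpace H] {I : ModelWithCorners ℝ E H}
  {M : Type*} [TopologicalSpace M] [ChartedSpace H M] [IsManifold I ∞ M]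
  (g : Bundle.ContMDiffRiemannianMetric I ∞ E (fun x : M => TangentSpace I x))

theorem mdifferentiableAt_metric {Y Z : ∀ x : M, TangentSpace I x} {x : M}
    (hY : MDiffAt (T% Y) x) (hZ : MDiffAt (T% Z) x) :
    MDiffAt (fun y => g.inner y (Y y) (Z y)) x := by
  have h := ((g.contMDiff x).mdifferentiableAt (by simp)).clm_bundle_apply₂ (F₃ := ℝ) hY hZ
  exact ((mdifferentiableAt_totalSpace ..).1 h).2

theorem contMDiffAt_metric {Y Z : ∀ x : M, TangentSpace I x} {x : M}
    (hY : CMDiffAt ∞ (T% Y) x) (hZ : CMDiffAt ∞ (T% Z) x) :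
    CMDiffAt ∞ (fun y => g.inner y (Y y) (Z y)) x :=
  (Bundle.contMDiffAt_totalSpace.1 ((g.contMDiff x).clm_bundle_apply₂ (F₃ := ℝ) hY hZ)).2

/-- The derivative of `g(Y, Z)` at `x` in the direction `v`. -/
def derivMetric (Y Z : ∀ x : M, TangentSpace I x) (x : M) (v : TangentSpace I x) : ℝ :=
  mvfderiv I (fun y => g.inner y (Y y) (Z y)) x v

variable {g} {Y Y' Z : ∀ x : M, TangentSpace I x} {x : M}

theorem derivMetric_symm (Y Z : ∀ x : M, TangentSpace I x) (v : TangentSpace I x) :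
    derivMetric g Y Z x v = derivMetric g Z Y x v := by
  simp only [derivMetric]
  congr 1
  congr 1
  funext y
  exact g.symm y _ _

theorem derivMetric_add_left (hY : MDiffAt (T% Y) x) (hY' : MDiffAt (T% Y') x)
    (hZ : MDiffAt (T% Z) x) (v : TangentSpace I x) :
    derivMetric g (Y + Y') Z x v = derivMetric g Y Z x v + derivMetric g Y' Z x v := by
  simp only [derivMetric, Pi.add_apply, map_add, add_apply]
  rw [mvfderiv_fun_add (mdifferentiableAt_metric g hY hZ) (mdifferentiableAt_metric g hY' hZ)]
  rfl

theorem derivMetric_add_right (hY : MDiffAt (T% Y) x) (hY' : MDiffAt (T% Y') x)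
    (hZ : MDiffAt (T% Z) x) (v : TangentSpace I x) :
    derivMetric g Z (Y + Y') x v = derivMetric g Z Y x v + derivMetric g Z Y' x v := by
  simp only [derivMetric_symm Z, derivMetric_add_left hY hY' hZ]

theorem derivMetric_smul_left {f : M → ℝ} (hf : MDiffAt f x) (hY : MDiffAt (T% Y) x)
    (hZ : MDiffAt (T% Z) x) (v : TangentSpace I x) :
    derivMetric g (f • Y) Z x v
      = f x * derivMetric g Y Z x v + mvfderiv I f x v * g.inner x (Y x) (Z x) := by
  simp only [derivMetric, Pi.smul_apply', map_smul, smul_apply, smul_eq_mul]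
  rw [mvfderiv_fun_mul hf (mdifferentiableAt_metric g hY hZ)]
  simp
  ring

theorem derivMetric_smul_right {f : M → ℝ} (hf : MDiffAt f x) (hY : MDiffAt (T% Y) x)
    (hZ : MDiffAt (T% Z) x) (v : TangentSpace I x) :
    derivMetric g Z (f • Y) x v
      = f x * derivMetric g Z Y x v + mvfderiv I f x v * g.inner x (Z x) (Y x) := by
  simp only [derivMetric_symm Z, derivMetric_smul_left hf hY hZ, g.symm x (Z x)]

theorem derivMetric_add (Y Z : ∀ x : M, TangentSpace I x) (v w : TangentSpace I x) :
    derivMetric g Y Z x (v + w) = derivMetric g Y Z x v + derivMetric g Y Z x w :=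
  map_add _ _ _

theorem derivMetric_smul (Y Z : ∀ x : M, TangentSpace I x) (c : ℝ) (v : TangentSpace I x) :
    derivMetric g Y Z x (c • v) = c * derivMetric g Y Z x v :=
  map_smul _ _ _

variable (g) in
/-- The right-hand side of the Koszul formula for `2 g(∇_X Y, Z)`. -/
def koszul (X Y Z : ∀ x : M, TangentSpace I x) (x : M) : ℝ :=
  derivMetric g Y Z x (X x) + derivMetric g Z X x (Y x) - derivMetric g X Y x (Z x)
    + g.inner x (VectorField.mlieBracket I X Y x) (Z x)
    - g.inner x (VectorField.mlieBracket I Y Z x) (X x)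
    + g.inner x (VectorField.mlieBracket I Z X x) (Y x)

/-- The source of torsion-freeness. -/
theorem koszul_sub_swap (X Y Z : ∀ x : M, TangentSpace I x) :
    koszul g X Y Z x - koszul g Y X Z x
      = 2 * g.inner x (VectorField.mlieBracket I X Y x) (Z x) := by
  simp only [koszul, derivMetric_symm Z, derivMetric_symm Y X]
  rw [VectorField.mlieBracket_swap_apply (V := Y) (W := X),
    VectorField.mlieBracket_swap_apply (V := Z) (W := X),
    VectorField.mlieBracket_swap_apply (V := Z) (W := Y)]
  simp only [map_neg, neg_apply]
  ring

/-- The source of metric compatibility. -/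
theorem koszul_add_swap (X Y Z : ∀ x : M, TangentSpace I x) :
    koszul g X Y Z x + koszul g X Z Y x = 2 * derivMetric g Y Z x (X x) := by
  simp only [koszul, derivMetric_symm Z, derivMetric_symm Y X]
  rw [VectorField.mlieBracket_swap_apply (V := Y) (W := X),
    VectorField.mlieBracket_swap_apply (V := Z) (W := X),
    VectorField.mlieBracket_swap_apply (V := Z) (W := Y)]
  simp only [map_neg, neg_apply]
  ring

theorem eq_of_inner_eq {u v : TangentSpace I x} (h : ∀ w, g.inner x u w = g.inner x v w) :
    u = v := by
  by_contra hne
  have h1 := g.pos x (u - v) (sub_ne_zero.2 hne)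
  have h2 : g.inner x (u - v) = 0 := by
    ext w
    simp [h w]
  rw [h2] at h1
  exact lt_irrefl _ h1

variable (g x) in
theorem exists_inner_eq [FiniteDimensional ℝ E] (l : TangentSpace I x →L[ℝ] ℝ) :
    ∃ u : TangentSpace I x, ∀ w, g.inner x u w = l w := by
  obtain ⟨e, he⟩ := isInvertible_of_pos (E := E) (b := g.inner x) (g.pos x)
  refine ⟨e.symm l, fun w => ?_⟩
  have h1 : (e (e.symm l) : E →L[ℝ] ℝ) = l := e.apply_symm_apply l
  have h2 : (e (e.symm l) : E →L[ℝ] ℝ) = g.inner x (e.symm l) :=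
    congrArg (fun T : E →L[ℝ] E →L[ℝ] ℝ => T (e.symm l)) he
  exact congrArg (fun T : E →L[ℝ] ℝ => T w) (h2.symm.trans h1)

variable [CompleteSpace E]

/-- The derivatives Y(f) and Z(f) produced by the metric terms cancel those produced by the
brackets. -/
theorem koszul_tensorial_left (hY : MDiffAt (T% Y) x) (hZ : MDiffAt (T% Z) x) :
    TensorialAt I E (fun X : (∀ y : M, TangentSpace I y) => koszul g X Y Z x) x where
  smul {f X} hf hX := by
    simp only [koszul, derivMetric_smul_left hf hX hY, derivMetric_smul_right hf hX hZ,
      VectorField.mlieBracket_smul_left hf hX, VectorField.mlieBracket_smul_right hf hX,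
      Pi.smul_apply', derivMetric_smul, map_add, map_smul, add_apply, smul_apply, smul_eq_mul,
      g.symm x (Z x) (X x)]
    ring
  add {X X'} hX hX' := by
    simp only [koszul, derivMetric_add_left hX hX' hY, derivMetric_add_right hX hX' hZ,
      VectorField.mlieBracket_add_left hX hX', VectorField.mlieBracket_add_right hX hX',
      Pi.add_apply, derivMetric_add, map_add, add_apply]
    ring

theorem koszul_tensorial_right {X : ∀ x : M, TangentSpace I x}
    (hX : MDiffAt (T% X) x) (hY : MDiffAt (T% Y) x) :
    TensorialAt I E (fun Z : (∀ y : M, TangentSpace I y) => koszul g X Y Z x) x where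
  smul {f Z} hf hZ := by
    simp only [koszul, derivMetric_smul_left hf hZ hX, derivMetric_smul_right hf hZ hY,
      VectorField.mlieBracket_smul_left hf hZ, VectorField.mlieBracket_smul_right hf hZ,
      Pi.smul_apply', derivMetric_smul, map_add, map_smul, add_apply, smul_apply, smul_eq_mul,
      g.symm x (Y x) (Z x)]
    ring
  add {Z Z'} hZ hZ' := by
    simp only [koszul, derivMetric_add_left hZ hZ' hX, derivMetric_add_right hZ hZ' hY,
      VectorField.mlieBracket_add_left hZ hZ', VectorField.mlieBracket_add_right hZ hZ',
      Pi.add_apply, derivMetric_add, map_add, add_apply]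
    ring

theorem koszul_add {X : ∀ x : M, TangentSpace I x} (hX : MDiffAt (T% X) x)
    (hY : MDiffAt (T% Y) x) (hY' : MDiffAt (T% Y') x) (hZ : MDiffAt (T% Z) x) :
    koszul g X (Y + Y') Z x = koszul g X Y Z x + koszul g X Y' Z x := by
  simp only [koszul, derivMetric_add_left hY hY' hZ, derivMetric_add_right hY hY' hX,
    VectorField.mlieBracket_add_left hY hY', VectorField.mlieBracket_add_right hY hY',
    Pi.add_apply, derivMetric_add, map_add, add_apply]
  ring

/-- In the middle slot the two X(f) terms add instead of cancelling; this is the Leibniz rule. -/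
theorem koszul_smul {X : ∀ x : M, TangentSpace I x} {f : M → ℝ} (hf : MDiffAt f x)
    (hX : MDiffAt (T% X) x) (hY : MDiffAt (T% Y) x) (hZ : MDiffAt (T% Z) x) :
    koszul g X (f • Y) Z x
      = f x * koszul g X Y Z x + 2 * (mvfderiv I f x (X x) * g.inner x (Y x) (Z x)) := by
  simp only [koszul, derivMetric_smul_left hf hY hZ, derivMetric_smul_right hf hY hX,
    VectorField.mlieBracket_smul_left hf hY, VectorField.mlieBracket_smul_right hf hY,
    Pi.smul_apply', derivMetric_smul, map_add, map_smul, add_apply, smul_apply, smul_eq_mul,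
    g.symm x (X x) (Y x)]
  ring

theorem contMDiffAt_mlieBracket {X Y : ∀ x : M, TangentSpace I x} {x : M}
    (hX : CMDiffAt ∞ (T% X) x) (hY : CMDiffAt ∞ (T% Y) x) :
    CMDiffAt ∞ (T% (VectorField.mlieBracket I X Y)) x := by
  have : IsManifold I (minSmoothness ℝ 2) M := by
    rw [minSmoothness_of_isRCLikeNormedField]
    infer_instance
  -- A bracket costs one derivative, but ∞ + 1 = ∞.
  have : IsManifold I (((⊤ : ℕ∞) : ℕ∞ω) + 1) M := ‹IsManifold I ∞ M›
  exact ContMDiffAt.mlieBracket_vectorField (m := ⊤) (n := ⊤) hX hY (by simp)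

theorem contMDiffAt_koszul {X : ∀ x : M, TangentSpace I x} (hX : CMDiffAt ∞ (T% X) x)
    (hY : CMDiffAt ∞ (T% Y) x) (hZ : CMDiffAt ∞ (T% Z) x) :
    CMDiffAt ∞ (koszul g X Y Z) x :=
  (((((contMDiffAt_mvfderiv_apply (contMDiffAt_metric g hY hZ) hX).add
    (contMDiffAt_mvfderiv_apply (contMDiffAt_metric g hZ hX) hY)).sub
    (contMDiffAt_mvfderiv_apply (contMDiffAt_metric g hX hY) hZ)).add
    (contMDiffAt_metric g (contMDiffAt_mlieBracket hX hY) hZ)).sub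
    (contMDiffAt_metric g (contMDiffAt_mlieBracket hY hZ) hX)).add
    (contMDiffAt_metric g (contMDiffAt_mlieBracket hZ hX) hY)

variable [FiniteDimensional ℝ E]

variable (g) in
theorem exists_koszul_eq (Y : ∀ x : M, TangentSpace I x) (x : M) :
    ∃ A : TangentSpace I x →L[ℝ] TangentSpace I x,
      MDiffAt (T% Y) x → ∀ X Z : (∀ x : M, TangentSpace I x), MDiffAt (T% X) x →
        MDiffAt (T% Z) x → 2 * g.inner x (A (X x)) (Z x) = koszul g X Y Z x := by
  by_cases hY : MDiffAt (T% Y) x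
  swap
  -- Default value 0 where Y is not differentiable; nothing is required there.
  · exact ⟨0, fun h => absurd h hY⟩
  have h1 : ∀ X : (∀ x : M, TangentSpace I x), MDiffAt (T% X) x → ∃ u : TangentSpace I x,
      ∀ Z : (∀ x : M, TangentSpace I x), MDiffAt (T% Z) x →
        2 * g.inner x u (Z x) = koszul g X Y Z x := by
    intro X hX
    -- For fixed X the Koszul expression is a linear form in Z(x), so the metric represents it by a
    -- vector.
    obtain ⟨u, hu⟩ := exists_inner_eq g x
      (TensorialAt.mkHom _ x (koszul_tensorial_right (g := g) hX hY))
    refine ⟨(1 / 2 : ℝ) • u, fun Z hZ => ?_⟩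
    have h2 := TensorialAt.mkHom_apply (koszul_tensorial_right (g := g) hX hY) hZ
    rw [← h2, ← hu]
    simp
  choose! F hF using h1
  -- The representing vector inherits tensoriality in X, because it is determined by its inner
  -- products.
  have hT : TensorialAt I E F x :=
    { smul := fun {f X} hf hX => by
        refine eq_of_inner_eq (g := g) fun w => ?_
        have hw := FiberBundle.mdifferentiableAt_extend I E (V := (TangentSpace I : M → Type _)) w
        have h2 := hF _ (hf.smul_section hX) _ hw
        have h3 := hF _ hX _ hw
        rw [(koszul_tensorial_left hY hw).smul hf hX, ← h3] at h2
        rw [FiberBundle.extend_apply_self] at h2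
        simp only [map_smul, smul_apply, smul_eq_mul] at h2 ⊢
        linarith
      add := fun {X X'} hX hX' => by
        refine eq_of_inner_eq (g := g) fun w => ?_
        have hw := FiberBundle.mdifferentiableAt_extend I E (V := (TangentSpace I : M → Type _)) w
        have h2 := hF _ (mdifferentiableAt_add_section hX hX') _ hw
        have h3 := hF _ hX _ hw
        have h4 := hF _ hX' _ hw
        rw [(koszul_tensorial_left hY hw).add hX hX', ← h3, ← h4] at h2
        rw [FiberBundle.extend_apply_self] at h2
        simp only [map_add, add_apply] at h2 ⊢
        linarith }
  refine ⟨TensorialAt.mkHom F x hT, fun _ X Z hX hZ => ?_⟩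
  rw [TensorialAt.mkHom_apply hT hX]
  exact hF X hX Z hZ

variable (g) in
/-- The underlying function of the Levi-Civita connection, determined by the Koszul formula. -/
def leviCivitaFun (Y : ∀ x : M, TangentSpace I x) (x : M) :
    TangentSpace I x →L[ℝ] TangentSpace I x :=
  (exists_koszul_eq g Y x).choose

theorem two_mul_inner_leviCivitaFun {X : ∀ x : M, TangentSpace I x} (hX : MDiffAt (T% X) x)
    (hY : MDiffAt (T% Y) x) (hZ : MDiffAt (T% Z) x) :
    2 * g.inner x (leviCivitaFun g Y x (X x)) (Z x) = koszul g X Y Z x :=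
  (exists_koszul_eq g Y x).choose_spec hY X Z hX hZ

theorem leviCivitaFun_eq {Y : ∀ x : M, TangentSpace I x} (hY : MDiffAt (T% Y) x)
    {A : TangentSpace I x →L[ℝ] TangentSpace I x}
    (h : ∀ X Z : (∀ x : M, TangentSpace I x), MDiffAt (T% X) x →
        MDiffAt (T% Z) x → 2 * g.inner x (A (X x)) (Z x) = koszul g X Y Z x) :
    leviCivitaFun g Y x = A := by
  ext v
  refine eq_of_inner_eq (g := g) fun w => ?_
  have hv := FiberBundle.mdifferentiableAt_extend I E (V := (TangentSpace I : M → Type _)) v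
  have hw := FiberBundle.mdifferentiableAt_extend I E (V := (TangentSpace I : M → Type _)) w
  have h1 := h _ _ hv hw
  rw [← two_mul_inner_leviCivitaFun hv hY hw] at h1
  simp only [FiberBundle.extend_apply_self] at h1
  linarith

variable (g) in
/-- The Levi-Civita connection of `g`. -/
def leviCivita : LinearConnection I M where
  toFun := leviCivitaFun g
  isCovariantDerivativeOnUniv :=
    { add := fun {Y Y' x} hY hY' _ => by
        refine leviCivitaFun_eq (mdifferentiableAt_add_section hY hY') fun X Z hX hZ => ?_
        rw [koszul_add hX hY hY' hZ, ← two_mul_inner_leviCivitaFun hX hY hZ,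
          ← two_mul_inner_leviCivitaFun hX hY' hZ]
        simp only [map_add, add_apply]
        ring
      leibniz := fun {Y f x} hY hf _ => by
        refine leviCivitaFun_eq (hf.smul_section hY) fun X Z hX hZ => ?_
        rw [koszul_smul hf hX hY hZ, ← two_mul_inner_leviCivitaFun hX hY hZ]
        simp only [map_add, add_apply, smul_apply, map_smul, ContinuousLinearMap.smulRight_apply,
          smul_eq_mul]
        ring }

variable (g) in
theorem isLeviCivita_leviCivita : IsLeviCivita (leviCivita g) g where
  smooth := by
    refine ⟨⟨fun {Y} hY x _ => ContMDiffAt.contMDiffWithinAt ?_⟩⟩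
    have hYs : ∀ x, CMDiffAt ∞ (T% Y) x := fun x => (hY x trivial).contMDiffAt Filter.univ_mem
    refine contMDiffAt_endo_of_apply fun X hX => contMDiffAt_of_inner g fun Z hZ => ?_
    have h1 := (contMDiffAt_const (c := (1 / 2 : ℝ))).mul (contMDiffAt_koszul (g := g) hX (hYs x) hZ)
    refine h1.congr_of_eventuallyEq ?_
    filter_upwards [eventually_mdifferentiableAt hX, eventually_mdifferentiableAt hZ] with y hXy hZy
    change g.inner y (leviCivitaFun g Y y (X y)) (Z y) = 1 / 2 * koszul g X Y Z y
    rw [← two_mul_inner_leviCivitaFun hXy ((hYs y).mdifferentiableAt (by simp)) hZy]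
    ring
  metric x v Y Z hY hZ := by
    have hv := FiberBundle.mdifferentiableAt_extend I E (V := (TangentSpace I : M → Type _)) v
    have h1 := koszul_add_swap (g := g) (x := x) (FiberBundle.extend E v) Y Z
    rw [← two_mul_inner_leviCivitaFun hv hY hZ, ← two_mul_inner_leviCivitaFun hv hZ hY,
      FiberBundle.extend_apply_self] at h1
    change derivMetric g Y Z x v = g.inner x (leviCivitaFun g Y x v) (Z x)
      + g.inner x (Y x) (leviCivitaFun g Z x v)
    rw [g.symm x (Y x)]
    linarith
  torsion_eq_zero := by
    refine congrFun ((leviCivita g).torsion_eq_zero_iff.2 fun {X Y x} hX hY => ?_)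
    refine eq_of_inner_eq (g := g) fun w => ?_
    have hw := FiberBundle.mdifferentiableAt_extend I E (V := (TangentSpace I : M → Type _)) w
    have h1 := koszul_sub_swap (g := g) (x := x) X Y (FiberBundle.extend E w)
    rw [← two_mul_inner_leviCivitaFun hX hY hw, ← two_mul_inner_leviCivitaFun hY hX hw,
      FiberBundle.extend_apply_self] at h1
    change g.inner x (leviCivitaFun g Y x (X x) - leviCivitaFun g X x (Y x)) w = _
    rw [map_sub, sub_apply]
    linarith

end LeviCivita

/-! ### Pointwise identities, the tensor ∇φ and the shifted connection -/

section Structure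

variable {E : Type*} [NormedAddCommGroup E] [NormedSpace ℝ E]
  {H : Type*} [TopologicalSpace H] {I : ModelWithCorners ℝ E H}
  {M : Type*} [TopologicalSpace M] [ChartedSpace H M] [IsManifold I ∞ M]

/-- The extension of a tangent vector to a vector field differentiable at its base point. -/
def extendVector {x : M} (v : TangentSpace I x) : ∀ y : M, TangentSpace I y :=
  FiberBundle.extend E v

@[simp]
theorem extendVector_self {x : M} (v : TangentSpace I x) : extendVector v x = v :=
  FiberBundle.extend_apply_self E v

theorem mdifferentiableAt_extendVector {x : M} (v : TangentSpace I x) :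
    MDiffAt (T% (extendVector v)) x :=
  FiberBundle.mdifferentiableAt_extend I E (V := (TangentSpace I : M → Type _)) v

theorem IsParallelMetric.derivMetric_eq {D : LinearConnection I M}
    {g : Bundle.ContMDiffRiemannianMetric I ∞ E (fun x : M => TangentSpace I x)}
    (hD : IsParallelMetric D g) {Y Z : ∀ x : M, TangentSpace I x} {x : M}
    (hY : MDiffAt (T% Y) x) (hZ : MDiffAt (T% Z) x) (v : TangentSpace I x) :
    derivMetric g Y Z x v = g.inner x (D Y x v) (Z x) + g.inner x (Y x) (D Z x v) :=
  hD x v Y Z hY hZ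

theorem LinearConnection.neg_apply (D : LinearConnection I M) {Y : ∀ x : M, TangentSpace I x}
    {x : M} (hY : MDiffAt (T% Y) x) (v : TangentSpace I x) :
    D (fun y => -Y y) x v = -D Y x v := by
  have h1 := D.isCovariantDerivativeOnUniv.smul_const (-1) hY
  have h2 : (fun y => -Y y) = (-1 : ℝ) • Y := by
    funext y
    simp
  rw [h2, h1]
  simp

section Torsion

variable [FiniteDimensional ℝ E] [CompleteSpace E]

theorem LinearConnection.torsion_apply (D : LinearConnection I M)
    {X Y : ∀ x : M, TangentSpace I x} {x : M} (hX : MDiffAt (T% X) x) (hY : MDiffAt (T% Y) x) :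
    D.torsion x (X x) (Y x)
      = D Y x (X x) - D X x (Y x) - VectorField.mlieBracket I X Y x :=
  CovariantDerivative.torsion_apply _ hX hY

/-- A metric connection is determined by its torsion. -/
theorem eq_of_isParallelMetric_of_torsion_eq {D D' : LinearConnection I M}
    {g : Bundle.ContMDiffRiemannianMetric I ∞ E (fun x : M => TangentSpace I x)}
    (hD : IsParallelMetric D g) (hD' : IsParallelMetric D' g)
    (hT : ∀ (x : M) (v w : TangentSpace I x), D.torsion x v w = D'.torsion x v w)
    {x : M} (v : TangentSpace I x) {Y : ∀ x : M, TangentSpace I x} (hY : MDiffAt (T% Y) x) :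
    D Y x v = D' Y x v := by
  -- The difference of the two connections, lowered by g. Metricity makes it skew in the last two
  -- slots, equality of torsions symmetric in the first two.
  let c : (∀ x : M, TangentSpace I x) → (∀ x : M, TangentSpace I x) →
    (∀ x : M, TangentSpace I x) → ℝ :=
    fun X Y Z => g.inner x (D Y x (X x)) (Z x) - g.inner x (D' Y x (X x)) (Z x)
  have skew : ∀ {X Y Z : ∀ x : M, TangentSpace I x}, MDiffAt (T% Y) x → MDiffAt (T% Z) x →
      c X Y Z = -c X Z Y := by
    intro X Y Z hY hZ
    have h1 := hD.derivMetric_eq hY hZ (X x)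
    have h2 := hD'.derivMetric_eq hY hZ (X x)
    rw [g.symm x (Y x)] at h1 h2
    simp only [c]
    linarith
  have sym : ∀ {X Y Z : ∀ x : M, TangentSpace I x}, MDiffAt (T% X) x → MDiffAt (T% Y) x →
      c X Y Z = c Y X Z := by
    intro X Y Z hX hY
    have h1 := hT x (X x) (Y x)
    rw [D.torsion_apply hX hY, D'.torsion_apply hX hY, sub_left_inj] at h1
    have h2 := congrArg (fun u => g.inner x u (Z x)) h1
    simp only [map_sub, sub_apply] at h2
    simp only [c]
    linarith
  refine eq_of_inner_eq (g := g) fun w => ?_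
  have hv := mdifferentiableAt_extendVector v
  have hw := mdifferentiableAt_extendVector w
  -- Alternating the two symmetries six times returns to the initial arguments with the opposite
  -- sign.
  have h1 := sym (Z := extendVector w) hv hY
  have h2 := skew (X := Y) hv hw
  have h3 := sym (Z := extendVector v) hY hw
  have h4 := skew (X := extendVector w) hY hv
  have h5 := sym (Z := Y) hw hv
  have h6 := skew (X := extendVector v) hw hY
  have h7 : c (extendVector v) Y (extendVector w) = 0 := by linarith
  simp only [c, extendVector_self] at h7
  linarith

end Torsion

namespace AlmostContactMetricStructure

variable (S : AlmostContactMetricStructure I M) {x : M}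

theorem inner_ξ_left (v : TangentSpace I x) : S.g.inner x (S.ξ x) v = S.η x v := by
  have h := S.g_φ_φ x (S.ξ x) v
  rw [S.φ_ξ, S.η_ξ] at h
  simp at h
  linarith

theorem inner_ξ_right (v : TangentSpace I x) : S.g.inner x v (S.ξ x) = S.η x v := by
  rw [S.g.symm, S.inner_ξ_left]

theorem inner_φ_left (v w : TangentSpace I x) :
    S.g.inner x (S.φ x v) w = -S.g.inner x v (S.φ x w) := by
  have h := S.g_φ_φ x v (S.φ x w)
  rw [S.φ_φ, S.η_φ] at h
  simp only [map_add, map_neg, map_smul, S.inner_ξ_right, S.η_φ] at h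
  simp at h
  linarith

theorem φ_φ_of_η_eq_zero {v : TangentSpace I x} (hv : S.η x v = 0) :
    S.φ x (S.φ x v) = -v := by
  rw [S.φ_φ, hv]
  simp

theorem mdifferentiableAt_ξ : MDiffAt (T% S.ξ) x :=
  (S.contMDiff_ξ x).mdifferentiableAt (by simp)

theorem mdifferentiableAt_η {X : ∀ x : M, TangentSpace I x} (hX : MDiffAt (T% X) x) :
    MDiffAt (fun y => S.η y (X y)) x := by
  simpa only [S.inner_ξ_left] using mdifferentiableAt_metric S.g S.mdifferentiableAt_ξ hX

theorem mvfderiv_η (X : ∀ x : M, TangentSpace I x) (v : TangentSpace I x) :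
    mvfderiv I (fun y => S.η y (X y)) x v = derivMetric S.g S.ξ X x v := by
  simp only [derivMetric, S.inner_ξ_left]

/-- An extension of v is projected along ξ at every point, since CR-integrability is stated for
global sections of ker η. -/
theorem exists_section_of_η_eq_zero {v : TangentSpace I x} (hv : S.η x v = 0) :
    ∃ X : ∀ x : M, TangentSpace I x, MDiffAt (T% X) x ∧ (∀ y, S.η y (X y) = 0) ∧ X x = v := by
  have hv' := mdifferentiableAt_extendVector v
  refine ⟨extendVector v - (fun y => S.η y (extendVector v y)) • S.ξ,
    mdifferentiableAt_sub_section hv'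
      ((S.mdifferentiableAt_η hv').smul_section S.mdifferentiableAt_ξ), fun y => ?_, ?_⟩
  · simp [S.η_ξ]
  · simp [hv]

/-- `Φ(Y, Z)` is differentiated as `g(Y, φ Z)`. -/
theorem mvfderiv_fundamentalForm (Y Z : ∀ x : M, TangentSpace I x) (v : TangentSpace I x) :
    mvfderiv I (fun y => S.fundamentalForm y (Y y) (Z y)) x v
      = derivMetric S.g Y (fun y => S.φ y (Z y)) x v := rfl

theorem derivMetric_φ_left (Y Z : ∀ x : M, TangentSpace I x) (v : TangentSpace I x) :
    derivMetric S.g (fun y => S.φ y (Y y)) Z x v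
      = -derivMetric S.g Y (fun y => S.φ y (Z y)) x v := by
  simp only [derivMetric, S.inner_φ_left]
  rw [mvfderiv_fun_neg]
  rfl

theorem contMDiffAt_φ {X : ∀ x : M, TangentSpace I x} (hX : CMDiffAt ∞ (T% X) x) :
    CMDiffAt ∞ (T% (fun y => S.φ y (X y))) x :=
  (S.contMDiff_φ x).clm_bundle_apply hX

variable {S} in
theorem connection_ξ_eq_zero {D : LinearConnection I M} (hg : IsParallelMetric D S.g)
    (hη : IsParallelOneForm D S.η)
    (v : TangentSpace I x) : D S.ξ x v = 0 := by
  refine eq_of_inner_eq (g := S.g) fun w => ?_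
  have hw := mdifferentiableAt_extendVector w
  have h1 := hg.derivMetric_eq S.mdifferentiableAt_ξ hw v
  have h2 := hη x v _ hw
  rw [S.mvfderiv_η, h1, S.inner_ξ_left, extendVector_self] at h2
  simp only [map_zero, zero_apply]
  linarith

variable {S} in
theorem isParallelOneForm_of_ξ {D : LinearConnection I M} (hg : IsParallelMetric D S.g)
    (hξ : ∀ (x : M) (v : TangentSpace I x), D S.ξ x v = 0) : IsParallelOneForm D S.η := by
  intro x v Y hY
  rw [S.mvfderiv_η, hg.derivMetric_eq S.mdifferentiableAt_ξ hY v, hξ, S.inner_ξ_left]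
  simp

variable {S} in
theorem η_connection_ξ {L : LinearConnection I M} (hL : IsParallelMetric L S.g)
    (v : TangentSpace I x) :
    S.η x (L S.ξ x v) = 0 := by
  have h1 := hL.derivMetric_eq S.mdifferentiableAt_ξ S.mdifferentiableAt_ξ v
  have h2 : derivMetric S.g S.ξ S.ξ x v = 0 := by
    simp [derivMetric, S.inner_ξ_left, S.η_ξ, mvfderiv_const]
  rw [h2, S.inner_ξ_left, S.inner_ξ_right] at h1
  linarith

/-- Both terms contribute df ⊗ φY, and these cancel. -/
theorem nablaPhi_tensorial (D : LinearConnection I M) (x : M) :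
    TensorialAt I E (fun Y : (∀ y : M, TangentSpace I y) =>
      D (fun y => S.φ y (Y y)) x - (S.φ x).comp (D Y x)) x where
  smul {f Y} hf hY := by
    have h1 : (fun y => S.φ y ((f • Y) y)) = f • (fun y => S.φ y (Y y)) := by
      ext y; simp
    rw [h1, D.isCovariantDerivativeOnUniv.leibniz (S.mdifferentiableAt_φ hY) hf,
      D.isCovariantDerivativeOnUniv.leibniz hY hf]
    ext v
    simp only [add_apply, sub_apply, smul_apply, ContinuousLinearMap.comp_apply,
      ContinuousLinearMap.smulRight_apply, map_add, map_smul]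
    module
  add {Y Y'} hY hY' := by
    have h1 : (fun y => S.φ y ((Y + Y') y)) = (fun y => S.φ y (Y y)) + (fun y => S.φ y (Y' y)) := by
      ext y; simp
    rw [h1, D.isCovariantDerivativeOnUniv.add (S.mdifferentiableAt_φ hY)
      (S.mdifferentiableAt_φ hY'), D.isCovariantDerivativeOnUniv.add hY hY']
    ext v
    simp only [add_apply, sub_apply, ContinuousLinearMap.comp_apply, map_add]
    module

variable {S} in
theorem η_connection_eq_zero {D : LinearConnection I M} (hη : IsParallelOneForm D S.η)
    {Y : ∀ x : M, TangentSpace I x} (hY : MDiffAt (T% Y) x) (hY0 : ∀ y, S.η y (Y y) = 0)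
    (v : TangentSpace I x) : S.η x (D Y x v) = 0 := by
  rw [← hη x v Y hY]
  simp [hY0, mvfderiv_const]

/-! ### The covariant derivative of `φ` -/

variable [FiniteDimensional ℝ E]

/-- The tensor `(Y, X) ↦ (∇_X φ) Y`. -/
def nablaPhi (D : LinearConnection I M) (x : M) :
    TangentSpace I x →L[ℝ] TangentSpace I x →L[ℝ] TangentSpace I x :=
  TensorialAt.mkHom _ x (S.nablaPhi_tensorial D x)

variable {S} in
theorem nablaPhi_apply {D : LinearConnection I M}
    {Y : ∀ x : M, TangentSpace I x} (hY : MDiffAt (T% Y) x)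
    (v : TangentSpace I x) :
    S.nablaPhi D x (Y x) v = D (fun y => S.φ y (Y y)) x v - S.φ x (D Y x v) :=
  congrArg (fun T : TangentSpace I x →L[ℝ] TangentSpace I x => T v)
    (TensorialAt.mkHom_apply (S.nablaPhi_tensorial D x) hY)

section NablaPhi

variable {S} {D : LinearConnection I M}

/-- Covariant differentiation by a metric connection preserves the skewness of φ. -/
theorem inner_nablaPhi_skew (hg : IsParallelMetric D S.g) (u v w : TangentSpace I x) :
    S.g.inner x (S.nablaPhi D x v u) w = -S.g.inner x (S.nablaPhi D x w u) v := by
  have hv := mdifferentiableAt_extendVector v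
  have hw := mdifferentiableAt_extendVector w
  have h1 := hg.derivMetric_eq (S.mdifferentiableAt_φ hv) hw u
  have h2 := hg.derivMetric_eq hv (S.mdifferentiableAt_φ hw) u
  rw [S.derivMetric_φ_left, h2] at h1
  have h3 := nablaPhi_apply (S := S) (D := D) hv u
  have h4 := nablaPhi_apply (S := S) (D := D) hw u
  simp only [extendVector_self] at h1 h3 h4
  rw [h3, h4]
  simp only [map_sub, sub_apply, S.inner_φ_left] at h1 ⊢
  rw [S.g.symm x (D _ x u) v, S.g.symm x (D (extendVector w) x u)]
  rw [S.inner_φ_left]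
  linarith

theorem nablaPhi_ξ (hξ : ∀ v : TangentSpace I x, D S.ξ x v = 0) (v : TangentSpace I x) :
    S.nablaPhi D x (S.ξ x) v = 0 := by
  rw [nablaPhi_apply S.mdifferentiableAt_ξ, hξ, map_zero, sub_zero]
  have h1 : (fun y => S.φ y (S.ξ y)) = 0 := funext fun y => S.φ_ξ y
  rw [h1, CovariantDerivative.zero]
  rfl

theorem η_nablaPhi (hg : IsParallelMetric D S.g) (hξ : ∀ v : TangentSpace I x, D S.ξ x v = 0)
    (u v : TangentSpace I x) : S.η x (S.nablaPhi D x v u) = 0 := by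
  rw [← S.inner_ξ_right, inner_nablaPhi_skew hg, nablaPhi_ξ hξ]
  simp

/-- Differentiate φ² = −I on sections of ker η, which the connection preserves because η is
parallel. -/
theorem nablaPhi_φ (hη : IsParallelOneForm D S.η) {v : TangentSpace I x} (hv : S.η x v = 0)
    (u : TangentSpace I x) :
    S.nablaPhi D x (S.φ x v) u = -S.φ x (S.nablaPhi D x v u) := by
  obtain ⟨Y, hY, hY0, rfl⟩ := S.exists_section_of_η_eq_zero hv
  rw [nablaPhi_apply hY, nablaPhi_apply (S.mdifferentiableAt_φ hY)]
  have h1 : (fun y => S.φ y (S.φ y (Y y))) = fun y => -Y y :=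
    funext fun y => S.φ_φ_of_η_eq_zero (hY0 y)
  rw [h1, D.neg_apply hY, map_sub, S.φ_φ_of_η_eq_zero (η_connection_eq_zero hη hY hY0 u)]
  abel

theorem isParallelEndo_of_nablaPhi (h : ∀ (x : M) (u v : TangentSpace I x),
    S.nablaPhi D x v u = 0) : IsParallelEndo D S.φ := by
  intro x v Y hY
  have h1 := nablaPhi_apply (S := S) (D := D) hY v
  rw [h] at h1
  exact sub_eq_zero.1 h1.symm

theorem nablaPhi_eq_zero (hφ : IsParallelEndo D S.φ) (u v : TangentSpace I x) :
    S.nablaPhi D x v u = 0 := by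
  have hv := mdifferentiableAt_extendVector v
  have h := nablaPhi_apply (S := S) (D := D) hv u
  rw [hφ x u _ hv, sub_self, extendVector_self] at h
  exact h

end NablaPhi

variable [CompleteSpace E]

theorem contMDiffAt_lieDeriv_apply {X : ∀ x : M, TangentSpace I x} (hX : CMDiffAt ∞ (T% X) x) :
    CMDiffAt ∞ (T% (fun y => S.lieDeriv y (X y))) x := by
  have h1 := (contMDiffAt_mlieBracket (S.contMDiff_ξ x) (S.contMDiffAt_φ hX)).sub_section
    (S.contMDiffAt_φ (contMDiffAt_mlieBracket (S.contMDiff_ξ x) hX))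
  refine h1.congr_of_eventuallyEq ?_
  filter_upwards [eventually_mdifferentiableAt hX] with y hy
  rw [S.lieDeriv_apply hy]
  rfl

/-- The endomorphism `I + h'`. -/
def idAddHPrime (α : ℝ) (x : M) : TangentSpace I x →L[ℝ] TangentSpace I x :=
  ContinuousLinearMap.id ℝ _ + S.hPrime α x

theorem idAddHPrime_apply (α : ℝ) (v : TangentSpace I x) :
    S.idAddHPrime α x v = v + S.hPrime α x v := rfl

theorem contMDiffAt_idAddHPrime_apply (α : ℝ) {X : ∀ x : M, TangentSpace I x}
    (hX : CMDiffAt ∞ (T% X) x) :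
    CMDiffAt ∞ (T% (fun y => S.idAddHPrime α y (X y))) x :=
  hX.add_section ((S.contMDiffAt_lieDeriv_apply (S.contMDiffAt_φ hX)).const_smul_section
    (a := 1 / (2 * α)))

theorem hPrime_ξ (α : ℝ) : S.hPrime α x (S.ξ x) = 0 := by
  simp [hPrime, S.φ_ξ]

theorem idAddHPrime_ξ (α : ℝ) : S.idAddHPrime α x (S.ξ x) = S.ξ x := by
  simp [idAddHPrime_apply, S.hPrime_ξ]

theorem lieDeriv_φ {α : ℝ} (hα : α ≠ 0) (v : TangentSpace I x) :
    S.lieDeriv x (S.φ x v) = (2 * α) • S.hPrime α x v := by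
  simp only [hPrime, smul_apply, ContinuousLinearMap.comp_apply, smul_smul]
  rw [mul_one_div_cancel (by simpa using hα), one_smul]

/-- The connection `D_X Y + α g(X + h' X, Y) ξ - α η(Y) (X + h' X)`. -/
def shift (α : ℝ) (D : LinearConnection I M) : LinearConnection I M where
  toFun Y x := D Y x
    + (α • (S.g.inner x (Y x)).comp (S.idAddHPrime α x)).smulRight (S.ξ x)
    - (α * S.η x (Y x)) • S.idAddHPrime α x
  isCovariantDerivativeOnUniv :=
    { add := fun {Y Y' x} hY hY' _ => by
        rw [D.isCovariantDerivativeOnUniv.add hY hY']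
        ext v
        simp only [Pi.add_apply, map_add, add_apply, sub_apply, smul_apply,
          ContinuousLinearMap.smulRight_apply, ContinuousLinearMap.comp_apply, smul_eq_mul]
        module
      leibniz := fun {Y f x} hY hf _ => by
        rw [D.isCovariantDerivativeOnUniv.leibniz hY hf]
        ext v
        simp only [Pi.smul_apply', map_smul, add_apply, sub_apply, smul_apply,
          ContinuousLinearMap.smulRight_apply, ContinuousLinearMap.comp_apply, smul_eq_mul]
        module }

theorem shift_apply (α : ℝ) (D : LinearConnection I M) (Y : ∀ x : M, TangentSpace I x)
    (v : TangentSpace I x) :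
    S.shift α D Y x v = D Y x v + (α * S.g.inner x (S.idAddHPrime α x v) (Y x)) • S.ξ x
      - (α * S.η x (Y x)) • S.idAddHPrime α x v := by
  rw [S.g.symm]
  rfl

theorem contMDiff_shift (α : ℝ) {D : LinearConnection I M}
    (hD : D.ContMDiffCovariantDerivative ∞) : (S.shift α D).ContMDiffCovariantDerivative ∞ := by
  refine ⟨⟨fun {Y} hY x _ => ContMDiffAt.contMDiffWithinAt ?_⟩⟩
  have hYx : CMDiffAt ∞ (T% Y) x := (hY x trivial).contMDiffAt Filter.univ_mem
  refine contMDiffAt_endo_of_apply fun X hX => ?_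
  have hDY := (hD.contMDiff.contMDiff hY x trivial).contMDiffAt Filter.univ_mem
  have h1 : CMDiffAt ∞ (T% (fun y => D Y y (X y))) x := hDY.clm_bundle_apply hX
  have hK := S.contMDiffAt_idAddHPrime_apply α hX
  have h2 : CMDiffAt ∞ (fun y => α * S.g.inner y (S.idAddHPrime α y (X y)) (Y y)) x :=
    contMDiffAt_const.mul (contMDiffAt_metric S.g hK hYx)
  have h3 : CMDiffAt ∞ (fun y => α * S.η y (Y y)) x := by
    have := (contMDiffAt_const (c := α)).mul (contMDiffAt_metric S.g (S.contMDiff_ξ x) hYx)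
    simp only [S.inner_ξ_left] at this
    exact this
  have h4 := (h1.add_section (h2.smul_section (S.contMDiff_ξ x))).sub_section (h3.smul_section hK)
  refine h4.congr_of_eventuallyEq (Filter.Eventually.of_forall fun y => ?_)
  simp only [shift_apply]
  rfl

/-- For each X, the added endomorphism Y ↦ α g(KX,Y)ξ − α η(Y)KX is skew. -/
theorem isParallelMetric_shift (α : ℝ) {D : LinearConnection I M} (hD : IsParallelMetric D S.g) :
    IsParallelMetric (S.shift α D) S.g := by
  intro x v Y Z hY hZ
  rw [hD x v Y Z hY hZ, shift_apply, shift_apply]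
  simp only [map_add, map_sub, map_smul, add_apply, sub_apply, smul_apply, smul_eq_mul,
    S.inner_ξ_left, S.inner_ξ_right, S.g.symm x (Y x) (S.idAddHPrime α x v)]
  ring

/-- Selfadjointness of K cancels the two ξ-terms under antisymmetrization. -/
theorem torsion_shift (α : ℝ) {D : LinearConnection I M} (hD : ∀ x, D.torsion x = 0)
    (hK : ∀ v w : TangentSpace I x,
      S.g.inner x (S.idAddHPrime α x v) w = S.g.inner x v (S.idAddHPrime α x w))
    (v w : TangentSpace I x) :
    (S.shift α D).torsion x v w
      = (α * S.η x v) • S.idAddHPrime α x w - (α * S.η x w) • S.idAddHPrime α x v := by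
  have hv := mdifferentiableAt_extendVector v
  have hw := mdifferentiableAt_extendVector w
  have h1 := (S.shift α D).torsion_apply hv hw
  have h2 := D.torsion_apply hv hw
  rw [hD] at h2
  rw [S.shift_apply, S.shift_apply] at h1
  simp only [extendVector_self, zero_apply] at h1 h2
  rw [h1, hK v w, S.g.symm x v, ← sub_eq_zero.1 h2.symm]
  module

/-! ### Consequences of the defining properties of the canonical connection -/

section Canonical

variable {S} {α : ℝ} {D : LinearConnection I M}

/-- Pair with ξ and use Kξ = ξ: η(Kv) = g(v, Kξ) = η(v). -/
theorem η_hPrime_of_isSelfAdjoint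
    (hK : ∀ v w : TangentSpace I x,
      S.g.inner x (S.idAddHPrime α x v) w = S.g.inner x v (S.idAddHPrime α x w))
    (v : TangentSpace I x) : S.η x (S.hPrime α x v) = 0 := by
  have h := hK v (S.ξ x)
  rw [S.idAddHPrime_ξ, S.inner_ξ_right, S.inner_ξ_right, idAddHPrime_apply, map_add] at h
  linarith

theorem torsion_eq_two_smul_halfTorsion (v w : TangentSpace I x) :
    D.torsion x v w = (2 : ℝ) • halfTorsion D x v w := by
  simp [halfTorsion, smul_smul]

namespace IsCanonicalConnection

/-- Split both arguments along ξ and ker η. The pure ξ-contributions on the right cancel because Kξ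
= ξ. -/
theorem torsion_eq (hD : S.IsCanonicalConnection α D) (v w : TangentSpace I x) :
    D.torsion x v w
      = (α * S.η x v) • S.idAddHPrime α x w - (α * S.η x w) • S.idAddHPrime α x v := by
  have key : ∀ u : TangentSpace I x, ∃ u' : TangentSpace I x, S.η x u' = 0 ∧
      u = S.η x u • S.ξ x + u' := fun u =>
    ⟨u - S.η x u • S.ξ x, by simp [S.η_ξ], by abel⟩
  obtain ⟨v', hv', hv⟩ := key v
  obtain ⟨w', hw', hw⟩ := key w
  have h1 : D.torsion x v' w' = 0 := by
    rw [torsion_eq_two_smul_halfTorsion, hD.torsion_D x v' w' hv' hw', smul_zero]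
  have h2 : ∀ u, S.η x u = 0 → D.torsion x (S.ξ x) u = α • S.idAddHPrime α x u := fun u hu => by
    rw [torsion_eq_two_smul_halfTorsion, hD.torsion_ξ x u hu]
    rfl
  have h3 : D.torsion x v' (S.ξ x) = -(α • S.idAddHPrime α x v') := by
    rw [← h2 v' hv']
    exact CovariantDerivative.torsion_antisymm _ _ _
  have h4 : D.torsion x (S.ξ x) (S.ξ x) = 0 := CovariantDerivative.torsion_self _ _
  generalize S.η x v = a at *
  generalize S.η x w = b at *
  subst hv hw
  simp only [map_add, map_smul, add_apply, smul_apply, h1, h3, h4, h2 w' hw', S.idAddHPrime_ξ]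
  module

/-- The normalized torsion in the direction ξ is (α/2)(K − η ⊗ ξ), and η ⊗ ξ is itself selfadjoint.
-/
theorem inner_idAddHPrime (hα : α ≠ 0) (hD : S.IsCanonicalConnection α D)
    (v w : TangentSpace I x) :
    S.g.inner x (S.idAddHPrime α x v) w = S.g.inner x v (S.idAddHPrime α x w) := by
  have h1 := hD.torsion_selfadjoint x v w
  have h2 : ∀ u, halfTorsion D x (S.ξ x) u
      = (1 / 2 * α) • (S.idAddHPrime α x u - S.η x u • S.ξ x) := fun u => by
    simp only [halfTorsion, smul_apply, hD.torsion_eq, S.η_ξ, S.idAddHPrime_ξ]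
    module
  rw [h2, h2] at h1
  simp only [map_sub, map_smul, sub_apply, smul_apply, smul_eq_mul, S.inner_ξ_left,
    S.inner_ξ_right] at h1
  have h3 := mul_left_cancel₀ (by simpa using hα) h1
  linarith

end IsCanonicalConnection

end Canonical

end AlmostContactMetricStructure

end Structure

/-! ### The equivalence, uniqueness and invariance under deformation -/

section Equivalence

variable {E : Type*} [NormedAddCommGroup E] [NormedSpace ℝ E]
  [FiniteDimensional ℝ E] [CompleteSpace E]
  {H : Type*} [TopologicalSpace H] {I : ModelWithCorners ℝ E H}
  {M : Type*} [TopologicalSpace M] [ChartedSpace H M] [IsManifold I ∞ M]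

theorem IsLeviCivita.mlieBracket_eq {L : LinearConnection I M}
    {g : Bundle.ContMDiffRiemannianMetric I ∞ E (fun x : M => TangentSpace I x)}
    (hL : IsLeviCivita L g) {X Y : ∀ x : M, TangentSpace I x} {x : M}
    (hX : MDiffAt (T% X) x) (hY : MDiffAt (T% Y) x) :
    VectorField.mlieBracket I X Y x = L Y x (X x) - L X x (Y x) := by
  have h := L.torsion_apply hX hY
  rw [hL.torsion_eq_zero] at h
  exact (sub_eq_zero.1 h.symm).symm

namespace AlmostContactMetricStructure

variable {S : AlmostContactMetricStructure I M} {α : ℝ} {x : M}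

/-! ### The Levi-Civita derivative of `ξ` -/

section LeviCivita

variable {L : LinearConnection I M}

/-- For a metric torsion-free connection, dη is the skew part of ∇ξ. -/
theorem IsAlmostKenmotsu.inner_connection_ξ (hS : S.IsAlmostKenmotsu α) (hL : IsLeviCivita L S.g)
    (v w : TangentSpace I x) :
    S.g.inner x (L S.ξ x v) w = S.g.inner x v (L S.ξ x w) := by
  have hv := mdifferentiableAt_extendVector v
  have hw := mdifferentiableAt_extendVector w
  have h1 := hS.d_η x _ _ hv hw
  simp only [extDerivOne, S.mvfderiv_η] at h1
  rw [hL.metric.derivMetric_eq S.mdifferentiableAt_ξ hv,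
    hL.metric.derivMetric_eq S.mdifferentiableAt_ξ hw, hL.mlieBracket_eq hv hw] at h1
  simp only [map_sub, S.inner_ξ_left, extendVector_self] at h1
  rw [S.g.symm x v]
  linarith

theorem IsAlmostKenmotsu.connection_ξ_ξ (hS : S.IsAlmostKenmotsu α) (hL : IsLeviCivita L S.g) :
    L S.ξ x (S.ξ x) = 0 := by
  refine eq_of_inner_eq (g := S.g) fun w => ?_
  rw [hS.inner_connection_ξ hL, S.inner_ξ_left, η_connection_ξ hL.metric]
  simp

/-- Since Φ(ξ,·) = 0, dΦ(ξ,·,·) is L_ξΦ, which must equal 2αΦ. Expand it by Leibniz with L_ξ g =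
2g(∇ξ·,·), valid because ∇ξ is selfadjoint. -/
theorem IsAlmostKenmotsu.lieDeriv_eq (hS : S.IsAlmostKenmotsu α) (hL : IsLeviCivita L S.g)
    (w : TangentSpace I x) :
    S.lieDeriv x w = (2 * α) • S.φ x w - (2 : ℝ) • L S.ξ x (S.φ x w) := by
  refine eq_of_inner_eq (g := S.g) fun v => ?_
  have hv := mdifferentiableAt_extendVector v
  have hw := mdifferentiableAt_extendVector w
  have hφ := S.mdifferentiableAt_φ hw
  have hξ := S.mdifferentiableAt_ξ (x := x)
  have h1 := hS.d_Φ x _ _ _ hξ hv hw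
  have z1 : mvfderiv I (fun y => S.fundamentalForm y (extendVector w y) (S.ξ y)) x = 0 := by
    simp [fundamentalForm, S.φ_ξ, mvfderiv_const]
  have z2 : mvfderiv I (fun y => S.fundamentalForm y (S.ξ y) (extendVector v y)) x = 0 := by
    simp [fundamentalForm, S.inner_ξ_left, S.η_φ, mvfderiv_const]
  simp only [extDerivTwo, z1, z2, wedgeOneTwo, S.mvfderiv_fundamentalForm, extendVector_self] at h1
  rw [hL.metric.derivMetric_eq hv hφ, hL.mlieBracket_eq hξ hv, hL.mlieBracket_eq hw hξ] at h1
  have h2 := S.lieDeriv_apply hw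
  rw [hL.mlieBracket_eq hξ hφ, hL.mlieBracket_eq hξ hw] at h2
  simp only [fundamentalForm, S.φ_ξ, S.inner_ξ_left, S.η_ξ, S.η_φ, map_zero, map_sub, sub_apply,
    zero_apply, extendVector_self] at h1 h2
  have h3 := hS.inner_connection_ξ hL v (S.φ x w)
  have h4 := S.inner_φ_left (L (extendVector w) x (S.ξ x)) v
  have h5 := S.inner_φ_left (L S.ξ x w) v
  rw [h2]
  simp only [map_sub, map_smul, sub_apply, smul_apply, smul_eq_mul]
  rw [S.g.symm x v (S.φ x w)] at h1
  rw [S.g.symm x v] at h1 h3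
  linarith

/-- Evaluate the preceding identity at φv, where L_ξφ becomes 2αh' and φ² is −I up to ξ; the ξ-part
is harmless since ∇_ξ ξ = 0. -/
theorem IsAlmostKenmotsu.connection_ξ (hα : α ≠ 0) (hS : S.IsAlmostKenmotsu α)
    (hL : IsLeviCivita L S.g) (v : TangentSpace I x) :
    L S.ξ x v = α • (S.idAddHPrime α x v - S.η x v • S.ξ x) := by
  have h1 := hS.lieDeriv_eq hL (S.φ x v)
  rw [S.lieDeriv_φ hα, S.φ_φ] at h1
  simp only [map_add, map_neg, map_smul, hS.connection_ξ_ξ hL, smul_zero, add_zero] at h1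
  rw [idAddHPrime_apply]
  have h2 : (2 : ℝ) • L S.ξ x v
      = (2 : ℝ) • α • (v + S.hPrime α x v - S.η x v • S.ξ x) := by
    have h3 : (2 : ℝ) • L S.ξ x v = (2 * α) • S.hPrime α x v
      - (2 * α) • (-v + S.η x v • S.ξ x) := by rw [h1]; module
    rw [h3]
    module
  exact smul_right_injective _ (two_ne_zero (α := ℝ)) h2

theorem IsAlmostKenmotsu.inner_idAddHPrime (hα : α ≠ 0) (hS : S.IsAlmostKenmotsu α)
    (v w : TangentSpace I x) :
    S.g.inner x (S.idAddHPrime α x v) w = S.g.inner x v (S.idAddHPrime α x w) := by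
  have hL := isLeviCivita_leviCivita S.g
  have h := hS.inner_connection_ξ hL v w
  rw [hS.connection_ξ hα hL, hS.connection_ξ hα hL] at h
  simp only [map_sub, map_smul, sub_apply, smul_apply, smul_eq_mul, S.inner_ξ_left,
    S.inner_ξ_right] at h
  have h3 := mul_left_cancel₀ hα h
  linarith

theorem IsAlmostKenmotsu.shift_ξ (hα : α ≠ 0) (hS : S.IsAlmostKenmotsu α)
    (hL : IsLeviCivita L S.g) (v : TangentSpace I x) : S.shift α L S.ξ x v = 0 := by
  rw [shift_apply, hS.connection_ξ hα hL, hS.inner_idAddHPrime hα, S.idAddHPrime_ξ,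
    S.inner_ξ_right, S.η_ξ]
  module

end LeviCivita

/-! ### `φ` is parallel -/

section NablaPhi

variable {D : LinearConnection I M}

/-- `[ξ, Y]` in terms of a connection with the torsion of the canonical connection. -/
theorem mlieBracket_ξ_eq (hξ : ∀ v : TangentSpace I x, D S.ξ x v = 0)
    (hT : ∀ v w : TangentSpace I x, D.torsion x v w
      = (α * S.η x v) • S.idAddHPrime α x w - (α * S.η x w) • S.idAddHPrime α x v)
    {Y : ∀ x : M, TangentSpace I x} (hY : MDiffAt (T% Y) x) :
    VectorField.mlieBracket I S.ξ Y x = D Y x (S.ξ x)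
      - (α • S.idAddHPrime α x (Y x) - (α * S.η x (Y x)) • S.ξ x) := by
  have h := D.torsion_apply S.mdifferentiableAt_ξ hY
  rw [hT, hξ, S.η_ξ, S.idAddHPrime_ξ, sub_zero, mul_one] at h
  rw [h]
  abel

theorem lieDeriv_eq_nablaPhi (hξ : ∀ v : TangentSpace I x, D S.ξ x v = 0)
    (hT : ∀ v w : TangentSpace I x, D.torsion x v w
      = (α * S.η x v) • S.idAddHPrime α x w - (α * S.η x w) • S.idAddHPrime α x v)
    (w : TangentSpace I x) :
    S.lieDeriv x w = S.nablaPhi D x w (S.ξ x)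
      - α • (S.hPrime α x (S.φ x w) - S.φ x (S.hPrime α x w)) := by
  have hw := mdifferentiableAt_extendVector w
  have h1 := S.lieDeriv_apply hw
  rw [mlieBracket_ξ_eq hξ hT hw, mlieBracket_ξ_eq hξ hT (S.mdifferentiableAt_φ hw)] at h1
  have h2 := nablaPhi_apply (S := S) (D := D) hw (S.ξ x)
  simp only [extendVector_self] at h1 h2
  rw [h1, h2]
  simp only [idAddHPrime_apply, map_sub, map_smul, map_add, S.φ_ξ, S.η_φ]
  module

/-- On `ker η`, `(∇_ξ φ) φ = α (h' - φ h' φ)`. -/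
theorem nablaPhi_φ_ξ (hα : α ≠ 0) (hξ : ∀ v : TangentSpace I x, D S.ξ x v = 0)
    (hT : ∀ v w : TangentSpace I x, D.torsion x v w
      = (α * S.η x v) • S.idAddHPrime α x w - (α * S.η x w) • S.idAddHPrime α x v)
    {w : TangentSpace I x} (hw : S.η x w = 0) :
    S.nablaPhi D x (S.φ x w) (S.ξ x)
      = α • (S.hPrime α x w - S.φ x (S.hPrime α x (S.φ x w))) := by
  have h1 := lieDeriv_eq_nablaPhi hξ hT (S.φ x w)
  rw [S.lieDeriv_φ hα, S.φ_φ_of_η_eq_zero hw, map_neg] at h1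
  rw [eq_add_of_sub_eq h1.symm]
  module

/-- On ker η, ∇_ξφ anticommutes with φ. Comparing this with `nablaPhi_φ_ξ` at w and at φw makes h' −
φh'φ equal to its own negative. -/
theorem φ_hPrime_φ (hα : α ≠ 0) (hξ : ∀ v : TangentSpace I x, D S.ξ x v = 0)
    (hη : IsParallelOneForm D S.η)
    (hT : ∀ v w : TangentSpace I x, D.torsion x v w
      = (α * S.η x v) • S.idAddHPrime α x w - (α * S.η x w) • S.idAddHPrime α x v)
    (hh : ∀ v : TangentSpace I x, S.η x (S.hPrime α x v) = 0)
    {w : TangentSpace I x} (hw : S.η x w = 0) :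
    S.φ x (S.hPrime α x (S.φ x w)) = S.hPrime α x w := by
  have h1 := nablaPhi_φ_ξ hα hξ hT hw
  have h2 := nablaPhi_φ_ξ hα hξ hT (S.η_φ x w)
  rw [nablaPhi_φ hη hw] at h1
  rw [S.φ_φ_of_η_eq_zero hw] at h2
  simp only [map_neg, neg_apply, sub_neg_eq_add] at h2
  have h3 := congrArg (S.φ x) h2
  rw [map_neg, h1, map_smul, map_add, S.φ_φ_of_η_eq_zero (hh w)] at h3
  have h4 := smul_right_injective _ hα h3
  have h5 : (2 : ℝ) • S.φ x (S.hPrime α x (S.φ x w)) = (2 : ℝ) • S.hPrime α x w := by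
    have h6 := sub_eq_zero.2 h4
    rw [← sub_eq_zero, ← neg_eq_zero, ← h6]
    module
  exact smul_right_injective _ (two_ne_zero (α := ℝ)) h5

theorem nablaPhi_apply_ξ (hα : α ≠ 0) (hξ : ∀ v : TangentSpace I x, D S.ξ x v = 0)
    (hη : IsParallelOneForm D S.η)
    (hT : ∀ v w : TangentSpace I x, D.torsion x v w
      = (α * S.η x v) • S.idAddHPrime α x w - (α * S.η x w) • S.idAddHPrime α x v)
    (hh : ∀ v : TangentSpace I x, S.η x (S.hPrime α x v) = 0)
    (v : TangentSpace I x) : S.nablaPhi D x v (S.ξ x) = 0 := by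
  have h1 := nablaPhi_φ_ξ hα hξ hT (S.η_φ x v)
  rw [φ_hPrime_φ hα hξ hη hT hh (S.η_φ x v), sub_self, smul_zero, S.φ_φ, map_add, map_neg,
    map_smul, add_apply, neg_apply, smul_apply, nablaPhi_ξ hξ, smul_zero, add_zero] at h1
  exact neg_eq_zero.1 h1

/-- The torsion of the canonical connection vanishes on `ker η`. -/
theorem mlieBracket_eq_of_η_eq_zero (hT : ∀ v w : TangentSpace I x, D.torsion x v w
      = (α * S.η x v) • S.idAddHPrime α x w - (α * S.η x w) • S.idAddHPrime α x v)
    {X Y : ∀ x : M, TangentSpace I x} (hX : MDiffAt (T% X) x) (hY : MDiffAt (T% Y) x)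
    (hX0 : S.η x (X x) = 0) (hY0 : S.η x (Y x) = 0) :
    VectorField.mlieBracket I X Y x = D Y x (X x) - D X x (Y x) := by
  have h := D.torsion_apply hX hY
  rw [hT, hX0, hY0] at h
  simp only [mul_zero, zero_smul, sub_zero] at h
  exact (sub_eq_zero.1 h.symm).symm

/-- Valid for any metric connection. With φ parallel only torsion remains; on ker η with zero
torsion only the cyclic sum of ∇φ does. -/
theorem extDerivTwo_eq_nablaPhi (hg : IsParallelMetric D S.g)
    {X Y Z : ∀ x : M, TangentSpace I x} (hX : MDiffAt (T% X) x) (hY : MDiffAt (T% Y) x)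
    (hZ : MDiffAt (T% Z) x) :
    extDerivTwo S.fundamentalForm X Y Z x
      = S.g.inner x (S.nablaPhi D x (Z x) (X x)) (Y x)
        + S.g.inner x (S.nablaPhi D x (X x) (Y x)) (Z x)
        + S.g.inner x (S.nablaPhi D x (Y x) (Z x)) (X x)
        + S.fundamentalForm x (D.torsion x (X x) (Y x)) (Z x)
        + S.fundamentalForm x (D.torsion x (Y x) (Z x)) (X x)
        + S.fundamentalForm x (D.torsion x (Z x) (X x)) (Y x) := by
  simp only [extDerivTwo, S.mvfderiv_fundamentalForm]
  simp only [D.torsion_apply hX hY, D.torsion_apply hY hZ, D.torsion_apply hZ hX,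
    nablaPhi_apply hX, nablaPhi_apply hY,
    nablaPhi_apply hZ, hg.derivMetric_eq hX (S.mdifferentiableAt_φ hY),
    hg.derivMetric_eq hY (S.mdifferentiableAt_φ hZ),
    hg.derivMetric_eq hZ (S.mdifferentiableAt_φ hX), fundamentalForm, map_sub, sub_apply,
    S.inner_φ_left]
  rw [S.g.symm x (Y x), S.g.symm x (Z x), S.g.symm x (X x)]
  ring

theorem IsAlmostKenmotsu.cyclic_nablaPhi (hS : S.IsAlmostKenmotsu α)
    (hg : IsParallelMetric D S.g)
    (hT : ∀ v w : TangentSpace I x, D.torsion x v w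
      = (α * S.η x v) • S.idAddHPrime α x w - (α * S.η x w) • S.idAddHPrime α x v)
    {u v w : TangentSpace I x} (hu : S.η x u = 0) (hv : S.η x v = 0) (hw : S.η x w = 0) :
    S.g.inner x (S.nablaPhi D x w u) v + S.g.inner x (S.nablaPhi D x u v) w
      + S.g.inner x (S.nablaPhi D x v w) u = 0 := by
  have h1 := extDerivTwo_eq_nablaPhi hg (mdifferentiableAt_extendVector u)
    (mdifferentiableAt_extendVector v) (mdifferentiableAt_extendVector w)
  rw [hS.d_Φ x _ _ _ (mdifferentiableAt_extendVector u) (mdifferentiableAt_extendVector v)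
    (mdifferentiableAt_extendVector w)] at h1
  simp only [extendVector_self, hT, hu, hv, hw, wedgeOneTwo, fundamentalForm, mul_zero, zero_smul,
    sub_zero, map_zero, zero_apply, zero_mul, add_zero] at h1
  exact h1.symm

/-- The Nijenhuis tensor of `φ` on `ker η` in terms of `∇φ`. -/
theorem nijenhuis_eq (hη : IsParallelOneForm D S.η)
    (hT : ∀ v w : TangentSpace I x, D.torsion x v w
      = (α * S.η x v) • S.idAddHPrime α x w - (α * S.η x w) • S.idAddHPrime α x v)
    {X Y : ∀ x : M, TangentSpace I x} (hX : MDiffAt (T% X) x) (hY : MDiffAt (T% Y) x)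
    (hX0 : ∀ y, S.η y (X y) = 0) (hY0 : ∀ y, S.η y (Y y) = 0) :
    VectorField.mlieBracket I (fun y => S.φ y (X y)) (fun y => S.φ y (Y y)) x
        - VectorField.mlieBracket I X Y x
        - S.φ x (VectorField.mlieBracket I (fun y => S.φ y (X y)) Y x
          + VectorField.mlieBracket I X (fun y => S.φ y (Y y)) x)
      = S.nablaPhi D x (Y x) (S.φ x (X x)) - S.nablaPhi D x (X x) (S.φ x (Y x))
        + S.φ x (S.nablaPhi D x (X x) (Y x)) - S.φ x (S.nablaPhi D x (Y x) (X x)) := by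
  have hφX := S.mdifferentiableAt_φ hX
  have hφY := S.mdifferentiableAt_φ hY
  rw [mlieBracket_eq_of_η_eq_zero hT hφX hφY (S.η_φ _ _) (S.η_φ _ _),
    mlieBracket_eq_of_η_eq_zero hT hX hY (hX0 _) (hY0 _),
    mlieBracket_eq_of_η_eq_zero hT hφX hY (S.η_φ _ _) (hY0 _),
    mlieBracket_eq_of_η_eq_zero hT hX hφY (hX0 _) (S.η_φ _ _)]
  simp only [nablaPhi_apply hX, nablaPhi_apply hY, map_add, map_sub,
    S.φ_φ_of_η_eq_zero (η_connection_eq_zero hη hX hX0 _),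
    S.φ_φ_of_η_eq_zero (η_connection_eq_zero hη hY hY0 _)]
  abel

/-- An almost Kähler structure on `ker η` with vanishing Nijenhuis tensor is Kähler. -/
theorem nablaPhi_eq_zero_of_η_eq_zero (hS : S.IsAlmostKenmotsu α) (hCR : S.IsCRIntegrable)
    (hg : IsParallelMetric D S.g) (hη : IsParallelOneForm D S.η)
    (hT : ∀ v w : TangentSpace I x, D.torsion x v w
      = (α * S.η x v) • S.idAddHPrime α x w - (α * S.η x w) • S.idAddHPrime α x v)
    {u v w : TangentSpace I x} (hu : S.η x u = 0) (hv : S.η x v = 0) (hw : S.η x w = 0) :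
    S.g.inner x (S.nablaPhi D x v u) w = 0 := by
  have hφu := S.η_φ x u
  have hφv := S.η_φ x v
  have hφw := S.η_φ x w
  have move : ∀ {b : TangentSpace I x} (a c : TangentSpace I x), S.η x b = 0 →
      S.g.inner x (S.nablaPhi D x (S.φ x b) a) c = S.g.inner x (S.nablaPhi D x b a) (S.φ x c) := by
    intro b a c hb
    rw [nablaPhi_φ hη hb, map_neg, neg_apply, S.inner_φ_left, neg_neg]
  obtain ⟨Y, hY, hY0, hYx⟩ := S.exists_section_of_η_eq_zero hv
  obtain ⟨Z, hZ, hZ0, hZx⟩ := S.exists_section_of_η_eq_zero hw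
  have hN := (hCR Y Z hY0 hZ0 x hY hZ).2
  rw [nijenhuis_eq hη hT hY hZ hY0 hZ0, hYx, hZx] at hN
  -- With F(a;b,c) = g((∇_aφ)b, c), pairing with φu gives F(φv;w,φu) − F(φw;v,φu) + F(w;v,u) −
  -- F(v;w,u) = 0.
  have e1 := congrArg (fun t => S.g.inner x t (S.φ x u)) hN
  simp only [map_add, map_sub, add_apply, sub_apply, S.inner_φ_left, S.φ_φ_of_η_eq_zero hu,
    map_zero, zero_apply, map_neg] at e1
  have c1 := hS.cyclic_nablaPhi hg hT hu hv hw
  -- Moving φ across turns this sum into F(u;w,v) = F(φw;v,φu) − F(φv;w,φu), which `e1` rewrites as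
  -- F(w;v,u) − F(v;w,u). By `c1` the latter is −F(u;w,v), so F(u;w,v) = 0.
  have c2 := hS.cyclic_nablaPhi hg hT hu hφv hφw
  have s1 := inner_nablaPhi_skew hg u w v
  have s2 := inner_nablaPhi_skew hg v u w
  have s3 := inner_nablaPhi_skew hg w u v
  have m1 := move u (S.φ x v) hw
  rw [S.φ_φ_of_η_eq_zero hv, map_neg] at m1
  have s4 := inner_nablaPhi_skew hg (S.φ x v) u (S.φ x w)
  have s5 := inner_nablaPhi_skew hg (S.φ x w) u (S.φ x v)
  have m2 := move (S.φ x v) u hw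
  have m3 := move (S.φ x w) u hv
  linarith

theorem isParallelEndo_of_isAlmostKenmotsu (hα : α ≠ 0) (hS : S.IsAlmostKenmotsu α)
    (hCR : S.IsCRIntegrable) (hg : IsParallelMetric D S.g) (hη : IsParallelOneForm D S.η)
    (hT : ∀ (x : M) (v w : TangentSpace I x), D.torsion x v w
      = (α * S.η x v) • S.idAddHPrime α x w - (α * S.η x w) • S.idAddHPrime α x v) :
    IsParallelEndo D S.φ := by
  refine isParallelEndo_of_nablaPhi fun x u v => ?_
  have hξ : ∀ v : TangentSpace I x, D S.ξ x v = 0 := connection_ξ_eq_zero hg hη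
  have hh := η_hPrime_of_isSelfAdjoint (hS.inner_idAddHPrime hα (x := x))
  -- Reduces each of the three arguments to ξ or to a vector in the image of φ, hence in ker η.
  have hφφ : ∀ a : TangentSpace I x, a = S.η x a • S.ξ x - S.φ x (S.φ x a) := fun a => by
    rw [S.φ_φ]
    abel
  have h1 : ∀ a b c : TangentSpace I x,
      S.g.inner x (S.nablaPhi D x (S.φ x b) (S.φ x a)) (S.φ x c) = 0 := fun a b c =>
    nablaPhi_eq_zero_of_η_eq_zero hS hCR hg hη (hT x) (S.η_φ x a) (S.η_φ x b) (S.η_φ x c)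
  refine eq_of_inner_eq (g := S.g) fun w => ?_
  rw [hφφ u, hφφ v, hφφ w]
  simp only [map_sub, map_smul, sub_apply, smul_apply, nablaPhi_ξ hξ,
    nablaPhi_apply_ξ hα hξ hη (hT x) hh, h1, S.inner_ξ_right, η_nablaPhi hg hξ]
  simp

end NablaPhi

/-! ### The two directions of the equivalence -/

section Main

variable {D : LinearConnection I M}

theorem isCanonicalConnection_of_torsion_eq (hs : D.ContMDiffCovariantDerivative ∞)
    (hφ : IsParallelEndo D S.φ) (hg : IsParallelMetric D S.g) (hη : IsParallelOneForm D S.η)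
    (hK : ∀ (x : M) (v w : TangentSpace I x),
      S.g.inner x (S.idAddHPrime α x v) w = S.g.inner x v (S.idAddHPrime α x w))
    (hT : ∀ (x : M) (v w : TangentSpace I x), D.torsion x v w
      = (α * S.η x v) • S.idAddHPrime α x w - (α * S.η x w) • S.idAddHPrime α x v) :
    S.IsCanonicalConnection α D where
  smooth := hs
  parallel_φ := hφ
  parallel_g := hg
  parallel_η := hη
  torsion_D x v w hv hw := by
    simp [halfTorsion, hT, hv, hw]
  torsion_ξ x v hv := by
    rw [← torsion_eq_two_smul_halfTorsion, hT, hv, S.η_ξ]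
    simp [idAddHPrime_apply]
  torsion_selfadjoint x v w := by
    simp only [halfTorsion, smul_apply, hT, map_sub, map_smul, sub_apply, smul_eq_mul, S.η_ξ,
      S.idAddHPrime_ξ, S.inner_ξ_left, S.inner_ξ_right, hK x v w]
    ring

theorem isCanonicalConnection_shift_leviCivita (hα : α ≠ 0) (hS : S.IsAlmostKenmotsu α)
    (hCR : S.IsCRIntegrable) : S.IsCanonicalConnection α (S.shift α (leviCivita S.g)) := by
  have hL := isLeviCivita_leviCivita S.g
  have hg := S.isParallelMetric_shift α hL.metric
  have hη := isParallelOneForm_of_ξ hg fun x v => hS.shift_ξ hα hL v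
  have hK : ∀ (x : M) (v w : TangentSpace I x),
      S.g.inner x (S.idAddHPrime α x v) w = S.g.inner x v (S.idAddHPrime α x w) :=
    fun x => hS.inner_idAddHPrime hα
  have hT := fun (x : M) => S.torsion_shift α hL.torsion_eq_zero (hK x)
  exact isCanonicalConnection_of_torsion_eq (S.contMDiff_shift α hL.smooth)
    (isParallelEndo_of_isAlmostKenmotsu hα hS hCR hg hη hT) hg hη hK hT

namespace IsCanonicalConnection

theorem connection_ξ (hD : S.IsCanonicalConnection α D) (v : TangentSpace I x) :
    D S.ξ x v = 0 :=
  connection_ξ_eq_zero hD.parallel_g hD.parallel_η v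

theorem isCRIntegrable (hD : S.IsCanonicalConnection α D) : S.IsCRIntegrable := by
  intro X Y hX0 hY0 x hX hY
  refine ⟨?_, ?_⟩
  · have hφX := S.mdifferentiableAt_φ hX
    have hφY := S.mdifferentiableAt_φ hY
    rw [mlieBracket_eq_of_η_eq_zero hD.torsion_eq hX hY (hX0 _) (hY0 _),
      mlieBracket_eq_of_η_eq_zero hD.torsion_eq hφX hφY (S.η_φ _ _) (S.η_φ _ _)]
    simp only [map_sub, η_connection_eq_zero hD.parallel_η hX hX0,
      η_connection_eq_zero hD.parallel_η hY hY0,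
      η_connection_eq_zero hD.parallel_η hφX fun y => S.η_φ _ _,
      η_connection_eq_zero hD.parallel_η hφY fun y => S.η_φ _ _, sub_self]
  · rw [nijenhuis_eq hD.parallel_η hD.torsion_eq hX hY hX0 hY0]
    simp [nablaPhi_eq_zero hD.parallel_φ]

/-- Equivalent to φh' + h'φ = 0, which is φh'φ = h' evaluated at φv together with h'ξ = 0. -/
theorem φ_idAddHPrime (hα : α ≠ 0) (hD : S.IsCanonicalConnection α D) (v : TangentSpace I x) :
    S.φ x (S.idAddHPrime α x v) + S.idAddHPrime α x (S.φ x v) = (2 : ℝ) • S.φ x v := by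
  have hh := η_hPrime_of_isSelfAdjoint (hD.inner_idAddHPrime hα (x := x))
  have h1 := φ_hPrime_φ hα hD.connection_ξ hD.parallel_η hD.torsion_eq hh (S.η_φ x v)
  rw [S.φ_φ] at h1
  simp only [map_add, map_neg, map_smul, S.hPrime_ξ, smul_zero, add_zero] at h1
  simp only [idAddHPrime_apply, map_add, ← h1]
  module

theorem isAlmostKenmotsu (hα : α ≠ 0) (hD : S.IsCanonicalConnection α D) :
    S.IsAlmostKenmotsu α where
  d_η x X Y hX hY := by
    have hh := η_hPrime_of_isSelfAdjoint (hD.inner_idAddHPrime hα (x := x))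
    have h1 := congrArg (S.η x) (D.torsion_apply hX hY)
    rw [hD.torsion_eq] at h1
    simp only [map_sub, map_smul, smul_eq_mul, idAddHPrime_apply, map_add, hh, add_zero] at h1
    simp only [extDerivOne]
    rw [hD.parallel_η x _ _ hX, hD.parallel_η x _ _ hY]
    linarith
  d_Φ x X Y Z hX hY hZ := by
    rw [extDerivTwo_eq_nablaPhi hD.parallel_g hX hY hZ]
    simp only [nablaPhi_eq_zero hD.parallel_φ, hD.torsion_eq, map_zero, zero_apply, zero_add,
      wedgeOneTwo, fundamentalForm, map_sub, map_smul, sub_apply, smul_apply, smul_eq_mul]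
    -- This is the coefficient of each αη(·) once the cyclic torsion sum is regrouped.
    have key : ∀ v w : TangentSpace I x, S.g.inner x (S.idAddHPrime α x v) (S.φ x w)
        - S.g.inner x (S.idAddHPrime α x w) (S.φ x v) = 2 * S.g.inner x v (S.φ x w) := by
      intro v w
      have h1 := congrArg (S.g.inner x v) (hD.φ_idAddHPrime hα w)
      simp only [map_add, map_smul, smul_eq_mul] at h1
      rw [hD.inner_idAddHPrime hα v, S.g.symm x (S.idAddHPrime α x w), S.inner_φ_left]
      linarith
    have k1 := key (Y x) (Z x)
    have k2 := key (Z x) (X x)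
    have k3 := key (X x) (Y x)
    linear_combination (α * S.η x (X x)) * k1 + (α * S.η x (Y x)) * k2 + (α * S.η x (Z x)) * k3

/-! ### Uniqueness and homothetic deformations -/

theorem eq (hD : S.IsCanonicalConnection α D) {D' : LinearConnection I M}
    (hD' : S.IsCanonicalConnection α D') (v : TangentSpace I x)
    {Y : ∀ x : M, TangentSpace I x} (hY : MDiffAt (T% Y) x) : D Y x v = D' Y x v :=
  eq_of_isParallelMetric_of_torsion_eq hD.parallel_g hD'.parallel_g
    (fun _ v w => (hD.torsion_eq v w).trans (hD'.torsion_eq v w).symm) v hY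

theorem eq_shift (hα : α ≠ 0) (hD : S.IsCanonicalConnection α D) {L : LinearConnection I M}
    (hL : IsLeviCivita L S.g) (v : TangentSpace I x)
    {Y : ∀ x : M, TangentSpace I x} (hY : MDiffAt (T% Y) x) : D Y x v = S.shift α L Y x v :=
  eq_of_isParallelMetric_of_torsion_eq hD.parallel_g (S.isParallelMetric_shift α hL.metric)
    (fun _ v w => (hD.torsion_eq v w).trans
      (S.torsion_shift α hL.torsion_eq_zero (hD.inner_idAddHPrime hα) v w).symm) v hY

end IsCanonicalConnection

theorem lieDeriv_deform {β : ℝ} (hβ : 0 < β) (v : TangentSpace I x) :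
    (S.deform β hβ).lieDeriv x v = (1 / β) • S.lieDeriv x v := by
  have hv := mdifferentiableAt_extendVector v
  have h1 := (S.deform β hβ).lieDeriv_apply hv
  have h2 := S.lieDeriv_apply hv
  rw [extendVector_self] at h1 h2
  rw [h1, h2]
  change VectorField.mlieBracket I ((1 / β) • S.ξ) (fun y => S.φ y (extendVector v y)) x
    - S.φ x (VectorField.mlieBracket I ((1 / β) • S.ξ) (extendVector v) x) = _
  rw [VectorField.mlieBracket_const_smul_left S.mdifferentiableAt_ξ,
    VectorField.mlieBracket_const_smul_left S.mdifferentiableAt_ξ, map_smul, smul_sub]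

/-- The factor 1/β from the new ξ cancels the β from the new constant. -/
theorem hPrime_deform {β : ℝ} (hβ : 0 < β) (v : TangentSpace I x) :
    (S.deform β hβ).hPrime (α / β) x v = S.hPrime α x v := by
  simp only [hPrime, smul_apply, ContinuousLinearMap.comp_apply]
  change _ • (S.deform β hβ).lieDeriv x (S.φ x v) = _
  rw [lieDeriv_deform, smul_smul]
  congr 1
  field_simp

theorem IsCanonicalConnection.deform (hα : α ≠ 0) (hD : S.IsCanonicalConnection α D) {β : ℝ}
    (hβ : 0 < β) : (S.deform β hβ).IsCanonicalConnection (α / β) D := by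
  have hK : ∀ (x : M) (v : TangentSpace I x),
      (S.deform β hβ).idAddHPrime (α / β) x v = S.idAddHPrime α x v := fun x v => by
    rw [idAddHPrime_apply, idAddHPrime_apply, hPrime_deform]
  have hηK : ∀ (x : M) (v : TangentSpace I x), S.η x (S.idAddHPrime α x v) = S.η x v :=
    fun x v => by
      rw [idAddHPrime_apply, map_add, η_hPrime_of_isSelfAdjoint (hD.inner_idAddHPrime hα),
        add_zero]
  have hinner : ∀ (x : M) (v w : TangentSpace I x), (S.deform β hβ).g.inner x v w
      = β * S.g.inner x v w + β * (β - 1) * (S.η x v * S.η x w) := fun x v w => by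
    simp [AlmostContactMetricStructure.deform]
  have hη' : ∀ (x : M) (v : TangentSpace I x), (S.deform β hβ).η x v = β * S.η x v :=
    fun x v => rfl
  refine isCanonicalConnection_of_torsion_eq hD.smooth hD.parallel_φ ?_ ?_ ?_ ?_
  · intro x v Y Z hY hZ
    have mY := S.mdifferentiableAt_η hY
    have mZ := S.mdifferentiableAt_η hZ
    have mg := mdifferentiableAt_metric S.g hY hZ
    have mη : MDiffAt (fun y => S.η y (Y y) * S.η y (Z y)) x := mY.mul mZ
    have m1 : MDiffAt (fun y => β * S.g.inner y (Y y) (Z y)) x := mdifferentiableAt_const.mul mg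
    have m2 : MDiffAt (fun y => β * (β - 1) * (S.η y (Y y) * S.η y (Z y))) x :=
      mdifferentiableAt_const.mul mη
    simp only [hinner]
    rw [mvfderiv_fun_add m1 m2, mvfderiv_fun_mul mdifferentiableAt_const mg,
      mvfderiv_fun_mul mdifferentiableAt_const mη, mvfderiv_fun_mul mY mZ]
    simp only [mvfderiv_const, add_apply, smul_apply, smul_zero, add_zero, smul_eq_mul,
      hD.parallel_η x v _ hY, hD.parallel_η x v _ hZ, hD.parallel_g x v _ _ hY hZ]
    ring
  · intro x v Y hY
    simp only [hη']
    rw [mvfderiv_fun_mul mdifferentiableAt_const (S.mdifferentiableAt_η hY)]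
    simp [mvfderiv_const, hD.parallel_η x v _ hY]
  · intro x v w
    -- K stays selfadjoint for the deformed metric because η ∘ K = η makes the extra η ⊗ η term
    -- symmetric.
    rw [hinner, hinner, hK, hK, hηK, hηK, hD.inner_idAddHPrime hα]
  · intro x v w
    rw [hD.torsion_eq, hK, hK, hη', hη']
    have h1 : ∀ c : ℝ, α / β * (β * c) = α * c := fun c => by field_simp
    rw [h1, h1]

end Main

end AlmostContactMetricStructure

end Equivalence

end

theorem mainTheorem2 {E : Type*} [NormedAddCommGroup E] [NormedSpace ℝ E] [FiniteDimensional ℝ E]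
    [CompleteSpace E] {H : Type*} [TopologicalSpace H] (I : ModelWithCorners ℝ E H) [I.Boundaryless]
    (M : Type*) [TopologicalSpace M] [T2Space M] [SecondCountableTopology M] [ChartedSpace H M]
    [IsManifold I ∞ M] (n : ℕ) (hdim : Module.finrank ℝ E = 2 * n + 1)
    (S : AlmostContactMetricStructure I M) (α : ℝ) (hα : α ≠ 0) :
    ((S.IsCRIntegrable ∧ S.IsAlmostKenmotsu α) ↔
      ∃ D : LinearConnection I M, S.IsCanonicalConnection α D) ∧
    ∀ D : LinearConnection I M, S.IsCanonicalConnection α D →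
      -- uniqueness
      (∀ D' : LinearConnection I M, S.IsCanonicalConnection α D' →
        ∀ (x : M) (Y : ∀ x : M, TangentSpace I x), MDiffAt (T% Y) x → D' Y x = D Y x) ∧
      -- the formula in terms of the Levi-Civita connection
      (∃ L : LinearConnection I M, IsLeviCivita L S.g) ∧
      (∀ L : LinearConnection I M, IsLeviCivita L S.g →
        ∀ (x : M) (v : TangentSpace I x) (Y : ∀ x : M, TangentSpace I x), MDiffAt (T% Y) x →
          D Y x v = L Y x v + (α * S.g.inner x (v + S.hPrime α x v) (Y x)) • S.ξ x
            - (α * S.η x (Y x)) • (v + S.hPrime α x v)) ∧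
      -- invariance under homothetic deformations
      (∀ (β : ℝ) (hβ : 0 < β), (S.deform β hβ).IsCanonicalConnection (α / β) D) := by
  refine ⟨⟨fun h => ⟨_, AlmostContactMetricStructure.isCanonicalConnection_shift_leviCivita
    hα h.2 h.1⟩, fun ⟨D, hD⟩ => ⟨hD.isCRIntegrable, hD.isAlmostKenmotsu hα⟩⟩, fun D hD =>
    ⟨fun D' hD' x Y hY => ?_, ⟨_, isLeviCivita_leviCivita S.g⟩, fun L hL x v Y hY => ?_,
      fun β hβ => hD.deform hα hβ⟩⟩
  · ext v
    exact hD'.eq hD v hY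
  · rw [hD.eq_shift hα hL v hY, S.shift_apply]
    rfl
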